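/- Let $k\ge 1$, $\ell\ge 3$ and $0<r\le k$ be integers. For $i\in\mathbb Z/2k$ let $Q_i$ be the regular $\ell$-gon with vertices $A(i,j)=(-1)^i e^{2\pi \sqrt{-1}\, j/\ell}$, $j\in\mathbb Z/\ell$, and let $M(i,j)$ be the midpoint of $[A(i,j),A(i,j+1)]$. Let $\mathcal M_{k,\ell}$ be the translation surface obtained from $\bigsqcup_i Q_i$ by gluing, by translation, for all $i,j$, the segment from $A(i,j)$ to $M(i,j)$ with the segment from $A(i+1,j+1)$ to $M(i+1,j)$. Let $G$ be the group, of order $4k\ell$, of affine diffeomorphisms of $\mathcal M_{k,\ell}$ generated by commuting elements $1_{2k}$ (mapping $A(i,j)$ to $A(i+1,j)$), $1_\ell$ (mapping $A(i,j)$ to $A(i,j+1)$), of orders $2k$ and $\ell$, and by the involution $\sigma$ (mapping $Q_i$ to $Q_{1-i}$ and $A(i,j)$ to $A(1-i,-j)$), which conjugates $1_{2k}$ and $1_\ell$ to their inverses. For integers $r,s$ let $\pi_{r,s}$ be the representation of $G$ on $\mathbb R^2=\mathbb C$ in which $1_{2k}$ acts by the rotation of angle $\pi r/k$, $1_\ell$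 by the rotation of angle $2\pi s/\ell$, and $\sigma$ by $z\mapsto-\bar z$. Let $H_r\subset H_1(\mathcal M_{k,\ell},\mathbb R)$ be the sum of all subrepresentations isomorphic to $\pi_{r,s}$ for some integer $s$ with $0<s<\ell$ and $\frac r{2k}+\frac s\ell\ne 1$ if $r<k$, and with $0<s<\ell/2$ if $r=k$; thus $H_r=\bigoplus_s\pi_{r,s}$ over these $s$. Then the subrepresentation $H_r$ is defined over $\mathbb Q$ if and only if $\frac r{2k}\in\{\frac16,\frac14,\frac13,\frac12\}$. This holds for both meanings of "defined over $\mathbb Q$": that the subspace $H_r$ is spanned over $\mathbb R$ by a $G$-subrepresentation of $H_1(\mathcal M_{k,\ell},\mathbb Q)$; and that $H_r$ is isomorphic, as a representation of $G$, to $\mathbb R\otimes_{\mathbb Q}V$ for some representation $V$ of $G$ over $\mathbb Q$. -/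

import Mathlib

open scoped TensorProduct

noncomputable section

namespace VeechMcMullen

/-! ### The polygons and their gluing

For `i : ZMod (2 * k)`, `Q_i` is a regular polygon with `ℓ` sides, whose vertices are listed
counterclockwise as `A(i, j)`, `j : ZMod ℓ`, with `A(i, j) = (-1) ^ i * exp (2 * π * I * j / ℓ)`.
Each side `[A(i, j), A(i, j + 1)]` is cut at its midpoint. -/

/-- The marked boundary points of the polygons: `A i j` is the vertex `A(i, j)` of `Q_i`, and
`M i j` is the midpoint of the side of `Q_i` from `A(i, j)` to `A(i, j + 1)`. -/
inductive Corner (k ℓ : ℕ) : Type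
  | A (i : ZMod (2 * k)) (j : ZMod ℓ) : Corner k ℓ
  | M (i : ZMod (2 * k)) (j : ZMod ℓ) : Corner k ℓ

/-- The oriented half-sides of the polygons: `plus i j` is the half-side of `Q_i` from `A(i, j)`
to the midpoint of `[A(i, j), A(i, j + 1)]`, and `minus i j` is the half-side of `Q_i` from
`A(i, j)` to the midpoint of `[A(i, j - 1), A(i, j)]`. -/
inductive Side (k ℓ : ℕ) : Type
  | plus (i : ZMod (2 * k)) (j : ZMod ℓ) : Side k ℓ
  | minus (i : ZMod (2 * k)) (j : ZMod ℓ) : Side k ℓ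

variable {k ℓ : ℕ}

/-- The initial point of an oriented half-side. -/
def Side.source : Side k ℓ → Corner k ℓ
  | .plus i j => .A i j
  | .minus i j => .A i j

/-- The terminal point of an oriented half-side. -/
def Side.target : Side k ℓ → Corner k ℓ
  | .plus i j => .M i j
  | .minus i j => .M i (j - 1)

/-- The gluing of the surface: the half-side `plus i j` of `Q_i` is identified with the half-side
`minus (i + 1) (j + 1)` of `Q_{i + 1}`, which is a translate of it. -/
inductive SideGlue : Side k ℓ → Side k ℓ → Prop
  | glue (i : ZMod (2 * k)) (j : ZMod ℓ) : SideGlue (.plus i j) (.minus (i + 1) (j + 1))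

/-- The identifications of marked points that result from the gluing of half-sides. -/
inductive CornerGlue : Corner k ℓ → Corner k ℓ → Prop
  | source {s t : Side k ℓ} (h : SideGlue s t) : CornerGlue s.source t.source
  | target {s t : Side k ℓ} (h : SideGlue s t) : CornerGlue s.target t.target

variable (k ℓ) in
/-- The 0-cells of the surface: the set `Σ` of its marked points. -/
def Vertex : Type := Quot (CornerGlue (k := k) (ℓ := ℓ))

variable (k ℓ) in
/-- The 1-cells of the surface: the images of the half-sides of the polygons. -/
def Edge : Type := Quot (SideGlue (k := k) (ℓ := ℓ))

/-- The point of the surface given by a marked point of a polygon. -/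
def Vertex.mk (c : Corner k ℓ) : Vertex k ℓ := Quot.mk _ c

/-- The 1-cell of the surface given by a half-side of a polygon. -/
def Edge.mk (s : Side k ℓ) : Edge k ℓ := Quot.mk _ s

/-- The initial point of a 1-cell. -/
def Edge.source : Edge k ℓ → Vertex k ℓ :=
  Quot.map Side.source fun _ _ h => CornerGlue.source h

/-- The terminal point of a 1-cell. -/
def Edge.target : Edge k ℓ → Vertex k ℓ :=
  Quot.map Side.target fun _ _ h => CornerGlue.target h

/-! ### The symmetry group -/

variable (k ℓ) in
/-- The group `G`, of order `4 * k * ℓ`: the element `⟨a, b, ε⟩` is the composition of the element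
`(a, b)` of `ℤ/2k × ℤ/ℓ` with the involution `σ` if `ε = -1`, and is `(a, b)` if `ε = 1`. -/
@[ext]
structure SymGroup : Type where
  a : ZMod (2 * k)
  b : ZMod ℓ
  ε : ℤˣ

namespace SymGroup

/-- The involution `σ` conjugates `(a, b)` to `(-a, -b)`. -/
instance : Mul (SymGroup k ℓ) :=
  ⟨fun g h => ⟨g.a + g.ε • h.a, g.b + g.ε • h.b, g.ε * h.ε⟩⟩

instance : One (SymGroup k ℓ) := ⟨⟨0, 0, 1⟩⟩

instance : Inv (SymGroup k ℓ) := ⟨fun g => ⟨-(g.ε • g.a), -(g.ε • g.b), g.ε⟩⟩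

theorem mul_def (g h : SymGroup k ℓ) :
    g * h = ⟨g.a + g.ε • h.a, g.b + g.ε • h.b, g.ε * h.ε⟩ := rfl

theorem one_def : (1 : SymGroup k ℓ) = ⟨0, 0, 1⟩ := rfl

theorem inv_def (g : SymGroup k ℓ) : g⁻¹ = ⟨-(g.ε • g.a), -(g.ε • g.b), g.ε⟩ := rfl

instance : Group (SymGroup k ℓ) :=
  Group.ofLeftAxioms
    (by intro x y z; ext <;> simp [mul_def, mul_smul, smul_add, add_assoc, mul_assoc])
    (by intro x; ext <;> simp [mul_def, one_def])
    (by
      intro x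
      rcases Int.units_eq_one_or x.ε with h | h <;> ext <;> simp [mul_def, one_def, inv_def, h])

end SymGroup

/-- The action of `(a, b)` in `ℤ/2k × ℤ/ℓ` on marked points of the polygons. -/
def Corner.shift (a : ZMod (2 * k)) (b : ZMod ℓ) : Corner k ℓ → Corner k ℓ
  | .A i j => .A (a + i) (b + j)
  | .M i j => .M (a + i) (b + j)

/-- The action of the involution `σ` on marked points: `Q_i` is reflected onto `Q_{1 - i}`. -/
def Corner.sigma : Corner k ℓ → Corner k ℓ
  | .A i j => .A (1 - i) (-j)
  | .M i j => .M (1 - i) (-j - 1)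

/-- The action of `(a, b)` in `ℤ/2k × ℤ/ℓ` on oriented half-sides. -/
def Side.shift (a : ZMod (2 * k)) (b : ZMod ℓ) : Side k ℓ → Side k ℓ
  | .plus i j => .plus (a + i) (b + j)
  | .minus i j => .minus (a + i) (b + j)

/-- The action of the involution `σ` on oriented half-sides. -/
def Side.sigma : Side k ℓ → Side k ℓ
  | .plus i j => .minus (1 - i) (-j)
  | .minus i j => .plus (1 - i) (-j)

/-- The action of the symmetry group on marked points of the polygons. -/
def Corner.act (g : SymGroup k ℓ) (c : Corner k ℓ) : Corner k ℓ :=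
  (if g.ε = 1 then c else c.sigma).shift g.a g.b

/-- The action of the symmetry group on oriented half-sides of the polygons. -/
def Side.act (g : SymGroup k ℓ) (s : Side k ℓ) : Side k ℓ :=
  (if g.ε = 1 then s else s.sigma).shift g.a g.b

theorem Side.act_one (s : Side k ℓ) : s.act 1 = s := by
  cases s <;> simp [Side.act, Side.shift, SymGroup.one_def]

theorem Side.act_mul (g h : SymGroup k ℓ) (s : Side k ℓ) : s.act (g * h) = (s.act h).act g := by
  obtain ⟨a, b, ε⟩ := g
  obtain ⟨c, d, δ⟩ := h
  have h1 : (-1 : ℤˣ) ≠ 1 := by decide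
  rcases Int.units_eq_one_or ε with rfl | rfl <;> rcases Int.units_eq_one_or δ with rfl | rfl <;>
    cases s <;> simp [Side.act, Side.shift, Side.sigma, SymGroup.mul_def, h1] <;>
    constructor <;> abel

theorem Corner.act_one (s : Corner k ℓ) : s.act 1 = s := by
  cases s <;> simp [Corner.act, Corner.shift, SymGroup.one_def]

theorem Corner.act_mul (g h : SymGroup k ℓ) (s : Corner k ℓ) :
    s.act (g * h) = (s.act h).act g := by
  obtain ⟨a, b, ε⟩ := g
  obtain ⟨c, d, δ⟩ := h
  have h1 : (-1 : ℤˣ) ≠ 1 := by decide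
  rcases Int.units_eq_one_or ε with rfl | rfl <;> rcases Int.units_eq_one_or δ with rfl | rfl <;>
    cases s <;> simp [Corner.act, Corner.shift, Corner.sigma, SymGroup.mul_def, h1] <;>
    constructor <;> abel

theorem Side.source_act (g : SymGroup k ℓ) (s : Side k ℓ) :
    (s.act g).source = s.source.act g := by
  rcases Int.units_eq_one_or g.ε with h | h <;> cases s <;>
    simp [Side.act, Side.shift, Side.sigma, Corner.act, Corner.shift, Corner.sigma, Side.source, h]

theorem Side.target_act (g : SymGroup k ℓ) (s : Side k ℓ) :
    (s.act g).target = s.target.act g := by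
  rcases Int.units_eq_one_or g.ε with h | h <;> cases s <;>
    simp [Side.act, Side.shift, Side.sigma, Corner.act, Corner.shift, Corner.sigma, Side.target,
      h] <;> abel

/-- The symmetries are compatible with the gluing (a symmetry of `ε = -1` exchanges the two sides
of a glued pair). -/
theorem SideGlue.act (g : SymGroup k ℓ) {s t : Side k ℓ} (h : SideGlue s t) :
    SideGlue (s.act g) (t.act g) ∨ SideGlue (t.act g) (s.act g) := by
  obtain ⟨i, j⟩ := h
  obtain ⟨a, b, ε⟩ := g
  have h1 : (-1 : ℤˣ) ≠ 1 := by decide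
  rcases Int.units_eq_one_or ε with rfl | rfl
  · left
    have := SideGlue.glue (a + i) (b + j)
    simpa [Side.act, Side.shift, add_assoc] using this
  · right
    have := SideGlue.glue (a + (1 - (i + 1))) (b + -(j + 1))
    have e1 : a + (1 - (i + 1)) + 1 = a + (1 - i) := by ring
    have e2 : b + -(j + 1) + 1 = b + -j := by ring
    rw [e1, e2] at this
    simpa [Side.act, Side.shift, Side.sigma, h1] using this

/-- The action of the symmetry group on the 1-cells of the surface. -/
instance : MulAction (SymGroup k ℓ) (Edge k ℓ) where
  smul g := Quot.lift (fun s => Quot.mk _ (s.act g)) fun _ _ h => by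
    rcases h.act g with h | h
    · exact Quot.sound h
    · exact (Quot.sound h).symm
  one_smul e := by
    induction e using Quot.ind with
    | mk s => exact congrArg (Quot.mk _) s.act_one
  mul_smul g h e := by
    induction e using Quot.ind with
    | mk s => exact congrArg (Quot.mk _) (s.act_mul g h)

/-- The action of the symmetry group on the 0-cells of the surface. -/
instance : MulAction (SymGroup k ℓ) (Vertex k ℓ) where
  smul g := Quot.lift (fun c => Quot.mk _ (c.act g)) fun _ _ h => by
    cases h with
    | source h =>
      rw [← Side.source_act, ← Side.source_act]
      rcases h.act g with h | h
      · exact Quot.sound (.source h)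
      · exact (Quot.sound (.source h)).symm
    | target h =>
      rw [← Side.target_act, ← Side.target_act]
      rcases h.act g with h | h
      · exact Quot.sound (.target h)
      · exact (Quot.sound (.target h)).symm
  one_smul e := by
    induction e using Quot.ind with
    | mk s => exact congrArg (Quot.mk _) s.act_one
  mul_smul g h e := by
    induction e using Quot.ind with
    | mk s => exact congrArg (Quot.mk _) (s.act_mul g h)

theorem Edge.source_smul (g : SymGroup k ℓ) (e : Edge k ℓ) : (g • e).source = g • e.source := by
  induction e using Quot.ind with
  | mk s => exact congrArg (Quot.mk _) (s.source_act g)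

theorem Edge.target_smul (g : SymGroup k ℓ) (e : Edge k ℓ) : (g • e).target = g • e.target := by
  induction e using Quot.ind with
  | mk s => exact congrArg (Quot.mk _) (s.target_act g)

theorem Edge.smul_mk (g : SymGroup k ℓ) (s : Side k ℓ) : g • Edge.mk s = Edge.mk (s.act g) := rfl

theorem Vertex.smul_mk (g : SymGroup k ℓ) (c : Corner k ℓ) :
    g • Vertex.mk c = Vertex.mk (c.act g) := rfl

theorem Edge.source_mk (s : Side k ℓ) : (Edge.mk s).source = Vertex.mk s.source := rfl

theorem Edge.target_mk (s : Side k ℓ) : (Edge.mk s).target = Vertex.mk s.target := rfl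

/-! ### Cellular homology -/

section Homology

variable (K : Type) [CommRing K]

variable (k ℓ) in
/-- The cellular boundary of 1-chains: an edge is sent to its terminal point minus its initial
point. -/
def boundary₁ : (Edge k ℓ →₀ K) →ₗ[K] (Vertex k ℓ →₀ K) :=
  Finsupp.linearCombination K fun e => Finsupp.single e.target 1 - Finsupp.single e.source 1

/-- The boundary of `Q_i`, run through counterclockwise: for each `j`, the half-side from
`A(i, j)` to the next midpoint, then backwards the half-side from `A(i, j + 1)` to this
midpoint. -/
def faceBoundary [NeZero ℓ] (i : ZMod (2 * k)) : Edge k ℓ →₀ K :=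
  ∑ j : ZMod ℓ, (Finsupp.single (Edge.mk (.plus i j)) 1
    - Finsupp.single (Edge.mk (.minus i (j + 1))) 1)

variable (k ℓ) in
/-- The cellular boundary of 2-chains; the 2-cells are the polygons `Q_i`, `i : ZMod (2 * k)`. -/
def boundary₂ [NeZero ℓ] : (ZMod (2 * k) →₀ K) →ₗ[K] (Edge k ℓ →₀ K) :=
  Finsupp.linearCombination K (faceBoundary K)

variable (k ℓ) in
/-- The space of cellular 1-cycles. -/
def Z₁ : Submodule K (Edge k ℓ →₀ K) := LinearMap.ker (boundary₁ k ℓ K)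

variable (k ℓ) in
/-- The space of cellular 1-boundaries. -/
def B₁ [NeZero ℓ] : Submodule K (Edge k ℓ →₀ K) := LinearMap.range (boundary₂ k ℓ K)

theorem boundary₁_boundary₂ [NeZero ℓ] (x : ZMod (2 * k) →₀ K) :
    boundary₁ k ℓ K (boundary₂ k ℓ K x) = 0 := by
  suffices h : boundary₁ k ℓ K ∘ₗ boundary₂ k ℓ K = 0 from LinearMap.congr_fun h x
  refine Finsupp.lhom_ext' fun i => LinearMap.ext_ring ?_
  have key : ∀ j : ZMod ℓ, boundary₁ k ℓ K
      (Finsupp.single (Edge.mk (.plus i j)) 1 - Finsupp.single (Edge.mk (.minus i (j + 1))) 1)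
      = Finsupp.single (Vertex.mk (.A i (j + 1))) 1 - Finsupp.single (Vertex.mk (.A i j)) 1 := by
    intro j
    simp [boundary₁, Edge.source_mk, Edge.target_mk, Side.source, Side.target]
  simp only [LinearMap.comp_apply, Finsupp.lsingle_apply, boundary₂,
    Finsupp.linearCombination_single, one_smul, faceBoundary, map_sum, key, LinearMap.zero_apply]
  rw [Finset.sum_sub_distrib, sub_eq_zero]
  exact Equiv.sum_comp (Equiv.addRight (1 : ZMod ℓ))
    fun j => (Finsupp.single (Vertex.mk (.A i j)) 1 : Vertex k ℓ →₀ K)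

variable (k ℓ) in
/-- The first homology group `Z₁ / B₁` of the surface with coefficients in `K`, as the space of
classes of 1-cycles in the quotient of the space of 1-chains by `B₁`. -/
def H₁ [NeZero ℓ] : Submodule K ((Edge k ℓ →₀ K) ⧸ B₁ k ℓ K) := (Z₁ k ℓ K).map (B₁ k ℓ K).mkQ

variable (k ℓ) in
/-- The representation of the symmetry group on 1-chains. -/
def chainRep : Representation K (SymGroup k ℓ) (Edge k ℓ →₀ K) where
  toFun g := Finsupp.lmapDomain K K (g • ·)
  map_one' := by
    refine Finsupp.lhom_ext' fun e => LinearMap.ext_ring ?_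
    simp
  map_mul' g h := by
    refine Finsupp.lhom_ext' fun e => LinearMap.ext_ring ?_
    simp [mul_smul]

theorem chainRep_single (g : SymGroup k ℓ) (e : Edge k ℓ) (c : K) :
    chainRep k ℓ K g (Finsupp.single e c) = Finsupp.single (g • e) c := by
  simp [chainRep]

theorem boundary₁_chainRep (g : SymGroup k ℓ) (x : Edge k ℓ →₀ K) :
    boundary₁ k ℓ K (chainRep k ℓ K g x) =
      Finsupp.lmapDomain K K (g • ·) (boundary₁ k ℓ K x) := by
  suffices h : boundary₁ k ℓ K ∘ₗ chainRep k ℓ K g =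
      Finsupp.lmapDomain K K (g • ·) ∘ₗ boundary₁ k ℓ K from LinearMap.congr_fun h x
  refine Finsupp.lhom_ext' fun e => LinearMap.ext_ring ?_
  simp only [LinearMap.comp_apply, Finsupp.lsingle_apply, chainRep_single, boundary₁,
    Finsupp.linearCombination_single, one_smul, Edge.source_smul, Edge.target_smul, map_sub,
    Finsupp.lmapDomain_apply, Finsupp.mapDomain_single]

theorem Z₁_le_comap (g : SymGroup k ℓ) : Z₁ k ℓ K ≤ (Z₁ k ℓ K).comap (chainRep k ℓ K g) := by
  intro x hx
  have hx' : boundary₁ k ℓ K x = 0 := hx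
  change boundary₁ k ℓ K (chainRep k ℓ K g x) = 0
  rw [boundary₁_chainRep, hx', map_zero]

/-- A symmetry sends the boundary of a polygon to plus or minus the boundary of a polygon. -/
theorem chainRep_faceBoundary [NeZero ℓ] (g : SymGroup k ℓ) (i : ZMod (2 * k)) :
    chainRep k ℓ K g (faceBoundary K i) ∈ B₁ k ℓ K := by
  have mem : ∀ i : ZMod (2 * k), (faceBoundary K i : Edge k ℓ →₀ K) ∈ B₁ k ℓ K := fun i =>
    ⟨Finsupp.single i 1, by simp [boundary₂]⟩
  obtain ⟨a, b, ε⟩ := g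
  have h1 : (-1 : ℤˣ) ≠ 1 := by decide
  rcases Int.units_eq_one_or ε with rfl | rfl
  · convert mem (a + i) using 1
    simp only [faceBoundary, map_sum, map_sub, chainRep_single]
    refine Fintype.sum_equiv (Equiv.addLeft b) _ _ fun j => ?_
    have e1 : (⟨a, b, 1⟩ : SymGroup k ℓ) • Edge.mk (Side.plus i j)
      = Edge.mk (Side.plus (a + i) (b + j)) := congrArg Edge.mk (by simp [Side.act, Side.shift])
    have e2 : (⟨a, b, 1⟩ : SymGroup k ℓ) • Edge.mk (Side.minus i (j + 1))
      = Edge.mk (Side.minus (a + i) (b + j + 1)) :=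
      congrArg Edge.mk (by simp [Side.act, Side.shift, add_assoc])
    rw [e1, e2]
    rfl
  · convert (B₁ k ℓ K).neg_mem (mem (a + (1 - i))) using 1
    simp only [faceBoundary, map_sum, map_sub, chainRep_single, ← Finset.sum_neg_distrib]
    refine Fintype.sum_equiv (Equiv.subLeft (b - 1)) _ _ fun j => ?_
    have e1 : (⟨a, b, -1⟩ : SymGroup k ℓ) • Edge.mk (Side.plus i j)
      = Edge.mk (Side.minus (a + (1 - i)) (b - 1 - j + 1)) :=
      congrArg Edge.mk (by simp [Side.act, Side.shift, Side.sigma, h1]; ring)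
    have e2 : (⟨a, b, -1⟩ : SymGroup k ℓ) • Edge.mk (Side.minus i (j + 1))
      = Edge.mk (Side.plus (a + (1 - i)) (b - 1 - j)) :=
      congrArg Edge.mk (by simp [Side.act, Side.shift, Side.sigma, h1]; ring)
    rw [e1, e2, neg_sub]
    rfl

theorem B₁_le_comap [NeZero ℓ] (g : SymGroup k ℓ) :
    B₁ k ℓ K ≤ (B₁ k ℓ K).comap (chainRep k ℓ K g) := by
  rintro _ ⟨x, rfl⟩
  induction x using Finsupp.induction_linear with
  | zero => simp
  | add x y hx hy => rw [map_add]; exact Submodule.add_mem _ hx hy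
  | single i c =>
    rw [Submodule.mem_comap, boundary₂, Finsupp.linearCombination_single, map_smul]
    exact Submodule.smul_mem _ _ (chainRep_faceBoundary K g i)

variable (k ℓ) in
/-- The representation of the symmetry group on the first homology group. -/
def homologyRep [NeZero ℓ] : Representation K (SymGroup k ℓ) (H₁ k ℓ K) :=
  ((chainRep k ℓ K).quotient (B₁ k ℓ K) (B₁_le_comap K)).subrepresentation (H₁ k ℓ K) <| by
    rintro g _ ⟨z, hz, rfl⟩
    exact ⟨chainRep k ℓ K g z, Z₁_le_comap K g hz, rfl⟩

end Homology

/-! ### Change of coefficients from `ℚ` to `ℝ` -/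

/-- Rational chains, seen as real chains. -/
def chainExt (X : Type) : (X →₀ ℚ) →ₛₗ[algebraMap ℚ ℝ] (X →₀ ℝ) where
  toFun x := x.mapRange (algebraMap ℚ ℝ) (map_zero _)
  map_add' x y := by ext; simp
  map_smul' c x := by ext; simp

theorem chainExt_single {X : Type} (e : X) (c : ℚ) :
    chainExt X (Finsupp.single e c) = Finsupp.single e (c : ℝ) := by
  simp [chainExt]

theorem boundary₁_chainExt (x : Edge k ℓ →₀ ℚ) :
    boundary₁ k ℓ ℝ (chainExt _ x) = chainExt _ (boundary₁ k ℓ ℚ x) := by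
  induction x using Finsupp.induction_linear with
  | zero => simp
  | add x y hx hy => simp only [map_add, hx, hy]
  | single e c =>
    simp [chainExt_single, boundary₁, smul_sub]

theorem boundary₂_chainExt [NeZero ℓ] (x : ZMod (2 * k) →₀ ℚ) :
    boundary₂ k ℓ ℝ (chainExt _ x) = chainExt _ (boundary₂ k ℓ ℚ x) := by
  induction x using Finsupp.induction_linear with
  | zero => simp
  | add x y hx hy => simp only [map_add, hx, hy]
  | single e c =>
    simp only [chainExt_single, boundary₂, faceBoundary, Finsupp.linearCombination_single,
      Finset.smul_sum, smul_sub, map_sum, map_sub, Finsupp.smul_single, smul_eq_mul, mul_one]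

variable (k ℓ) in
/-- The map from rational 1-chains modulo boundaries to real 1-chains modulo boundaries. -/
def chainQuotExt [NeZero ℓ] :
    ((Edge k ℓ →₀ ℚ) ⧸ B₁ k ℓ ℚ) →ₛₗ[algebraMap ℚ ℝ] ((Edge k ℓ →₀ ℝ) ⧸ B₁ k ℓ ℝ) :=
  Submodule.mapQ _ _ (chainExt (Edge k ℓ)) <| by
    rintro _ ⟨y, rfl⟩
    exact ⟨chainExt _ y, boundary₂_chainExt y⟩

variable (k ℓ) in
/-- The canonical map from rational homology to real homology, sending the class of a cycle to the
class of the same cycle. -/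
def homologyExt [NeZero ℓ] : H₁ k ℓ ℚ →ₛₗ[algebraMap ℚ ℝ] H₁ k ℓ ℝ :=
  (chainQuotExt k ℓ).restrict <| by
    rintro _ ⟨z, hz, rfl⟩
    have hz' : boundary₁ k ℓ ℚ z = 0 := hz
    refine ⟨chainExt _ z, ?_, rfl⟩
    change boundary₁ k ℓ ℝ (chainExt _ z) = 0
    rw [boundary₁_chainExt, hz', map_zero]

/-! ### The representations `π_{r,s}` and the subrepresentations `H_r` -/

section Pi

variable [NeZero k] [NeZero ℓ]

/-- The element `exp (2 * π * I * (r * a / (2 * k) + s * b / ℓ))` of the unit circle. -/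
def rotation (r : ZMod (2 * k)) (s : ZMod ℓ) (g : SymGroup k ℓ) : ℂ :=
  (ZMod.toCircle (r * g.a) : ℂ) * (ZMod.toCircle (s * g.b) : ℂ)

/-- The linear symmetry of the plane `ℂ` with respect to the imaginary axis. -/
def reflection : ℂ →ₗ[ℝ] ℂ := -Complex.conjLIE.toLinearEquiv.toLinearMap

theorem reflection_apply (z : ℂ) : reflection z = -(starRingEnd ℂ) z := rfl

/-- The real representation `π_{r,s}` of the symmetry group on the plane `ℂ`: the generator of
`ℤ/2k` acts by the rotation of angle `π * r / k`, the generator of `ℤ/ℓ` by the rotation of angle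
`2 * π * s / ℓ`, and `σ` by the symmetry with respect to the imaginary axis. -/
def planeRep (r : ZMod (2 * k)) (s : ZMod ℓ) : Representation ℝ (SymGroup k ℓ) ℂ where
  toFun g := LinearMap.mulLeft ℝ (rotation r s g) ∘ₗ
    (if g.ε = 1 then LinearMap.id else reflection)
  map_one' := by
    ext z <;> simp [rotation, SymGroup.one_def]
  map_mul' g h := by
    obtain ⟨a, b, ε⟩ := g
    obtain ⟨c, d, δ⟩ := h
    have h1 : (-1 : ℤˣ) ≠ 1 := by decide
    refine LinearMap.ext fun z => ?_
    rcases Int.units_eq_one_or ε with rfl | rfl <;>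
      rcases Int.units_eq_one_or δ with rfl | rfl <;>
      simp [rotation, SymGroup.mul_def, h1, reflection_apply, mul_add, AddChar.map_add_eq_mul,
        AddChar.map_neg_eq_inv, Circle.coe_inv_eq_conj, -Circle.coe_inv, -mul_neg, mul_neg (r : ZMod (2 * k)),
        mul_neg (s : ZMod ℓ)] <;> ring

variable (k ℓ) in
/-- The indices `s` of the summands `π_{r,s}` of `H_r`: those with `0 < s < ℓ` and
`r / 2k + s / ℓ ≠ 1` if `0 < r < k`, and those with `0 < s < ℓ / 2` if `r = k`. -/
def IsSummandIndex (r s : ℕ) : Prop :=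
  (r < k ∧ 0 < s ∧ s < ℓ ∧ (r : ℚ) / (2 * k) + (s : ℚ) / ℓ ≠ 1) ∨
    (r = k ∧ 0 < s ∧ (s : ℚ) < (ℓ : ℚ) / 2)

variable (k ℓ) in
/-- `V` is isomorphic to one of the summands `π_{r,s}` of `H_r`. -/
def IsSummand (r : ℕ) (V : Subrepresentation (homologyRep k ℓ ℝ)) : Prop :=
  ∃ s : ℕ, IsSummandIndex k ℓ r s ∧
    Nonempty (V.toRepresentation.Equiv (planeRep (r : ZMod (2 * k)) (s : ZMod ℓ)))

variable (k ℓ) in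
/-- The subrepresentation `H_r` of the real homology: the sum of all its subrepresentations that
are isomorphic to one of the summands `π_{r,s}` of `H_r`. -/
def Hr (r : ℕ) : Subrepresentation (homologyRep k ℓ ℝ) where
  toSubmodule := ⨆ V : {V // IsSummand k ℓ r V}, V.1.toSubmodule
  apply_mem_toSubmodule g v hv := by
    have hle : (⨆ V : {V // IsSummand k ℓ r V}, V.1.toSubmodule) ≤
        (⨆ V : {V // IsSummand k ℓ r V}, V.1.toSubmodule).comap (homologyRep k ℓ ℝ g) :=
      iSup_le fun V x hx =>
        Submodule.mem_iSup_of_mem V (V.1.apply_mem_toSubmodule g hx)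
    exact hle hv

end Pi

/-! ### Being defined over `ℚ` -/

/-- A subrepresentation of the real homology is defined over `ℚ`, as a subspace, if it is spanned
over `ℝ` by a subrepresentation of the rational homology. -/
def IsRationalSubspace [NeZero ℓ] (U : Subrepresentation (homologyRep k ℓ ℝ)) : Prop :=
  ∃ W : Subrepresentation (homologyRep k ℓ ℚ),
    U.toSubmodule = Submodule.span ℝ (homologyExt k ℓ '' (W.toSubmodule : Set (H₁ k ℓ ℚ)))

/-- A real representation `τ` of a group is defined over `ℚ`, as a representation, if it is
isomorphic to the extension of scalars of a representation `ρ` over `ℚ`. -/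
def IsRealizableOverRat {G U : Type} [Group G] [AddCommMonoid U] [Module ℝ U]
    (τ : Representation ℝ G U) : Prop :=
  ∃ (V : Type) (_ : AddCommGroup V) (_ : Module ℚ V) (ρ : Representation ℚ G V)
    (e : (ℝ ⊗[ℚ] V) ≃ₗ[ℝ] U), ∀ (g : G) (x : ℝ ⊗[ℚ] V), e ((ρ g).baseChange ℝ x) = τ g (e x)

end VeechMcMullen

end

/-! Let `T` (`angleOp`) be the sum of the actions on homology of the generator of `ℤ/2k` and of its
inverse. It is defined over `ℚ`, and it commutes with `G` because `σ` exchanges its two terms. On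
`π_{r,s}` it is the scalar `2 cos (π r / k)` (`angleTrace`), whatever `s` is. The heart of the proof
is that `H_r` is the full eigenspace of `T` for this scalar (`angleOp_of_mem_Hr`,
`mem_Hr_of_angleOp`).

If the scalar is rational, its eigenspace is spanned by rational classes
(`isRationalSubspace_of_eigenspace`). A rational subspace yields a rational form of the
representation (`IsRationalSubspace.isRealizableOverRat`). In a rational form of the nonzero space
`H_r`, the sum of the two group elements is a rational endomorphism and a scalar, so the scalar is
rational (`IsRealizableOverRat.exists_rat`). Both notions thus amount to the rationality of `2 cos
(π r / k)`, which Niven's theorem decides.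

The eigenspace is found by Fourier analysis: the 1-cells form a torsor under `ℤ/2k × ℤ/ℓ`, so real
chains are sums of waves indexed by characters `χ`. Cycles have no component with `χ (1, 1) = 1`;
waves with `χ` trivial on `ℤ/ℓ` and `χ (1, 0) ≠ 1` are boundaries; and `T` determines the first
parameter of `χ` up to sign on the remaining components. What survives is exactly the planes that
make up `H_r`. -/

noncomputable section

namespace VeechMcMullen

/-! ### Waves: real Fourier components indexed by characters of a finite abelian group -/

section Wave

variable {N M M' : Type*} [AddCommGroup N] [Fintype N] [AddCommGroup M] [Module ℝ M]
  [AddCommGroup M'] [Module ℝ M']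

/-- The real-linear map `z ↦ ∑ n, Re (χ (-n) * z) • f n`. -/
def wave (χ : AddChar N Circle) (f : N → M) : ℂ →ₗ[ℝ] M :=
  ∑ n, (Complex.reLm ∘ₗ LinearMap.mulLeft ℝ (χ (-n) : ℂ)).smulRight (f n)

theorem wave_apply (χ : AddChar N Circle) (f : N → M) (z : ℂ) :
    wave χ f z = ∑ n, ((χ (-n) : ℂ) * z).re • f n := by
  simp [wave]

theorem map_wave (g : M →ₗ[ℝ] M') (χ : AddChar N Circle) (f : N → M) (z : ℂ) :
    g (wave χ f z) = wave χ (fun n => g (f n)) z := by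
  simp [wave_apply]

theorem wave_sub (χ : AddChar N Circle) (f g : N → M) (z : ℂ) :
    wave χ (fun n => f n - g n) z = wave χ f z - wave χ g z := by
  simp [wave_apply, smul_sub]

theorem wave_sum {ι : Type*} (s : Finset ι) (χ : AddChar N Circle) (f : ι → N → M) (z : ℂ) :
    wave χ (fun n => ∑ i ∈ s, f i n) z = ∑ i ∈ s, wave χ (f i) z := by
  simp only [wave_apply, Finset.smul_sum]
  exact Finset.sum_comm

/-- Reindexing the sum moves the translation onto the phase, so translations act on the space of
waves as rotations. -/
theorem wave_shift (χ : AddChar N Circle) (f : N → M) (m : N) (z : ℂ) :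
    wave χ (fun n => f (m + n)) z = wave χ f (χ m * z) := by
  simp only [wave_apply]
  refine Fintype.sum_equiv (Equiv.addLeft m) _ _ fun n => ?_
  rw [Equiv.coe_addLeft, neg_add, AddChar.map_add_eq_mul, AddChar.map_neg_eq_inv χ m]
  congr 2
  push_cast
  have : (χ m : ℂ) ≠ 0 := Circle.coe_ne_zero _
  field_simp

theorem wave_neg (χ : AddChar N Circle) (f : N → M) (z : ℂ) :
    wave χ (fun n => f (-n)) z = wave χ f (starRingEnd ℂ z) := by
  simp only [wave_apply]
  refine Fintype.sum_equiv (Equiv.neg N) _ _ fun n => ?_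
  rw [Equiv.neg_apply, neg_neg, AddChar.map_neg_eq_inv, Circle.coe_inv_eq_conj, ← Complex.conj_re]
  simp

/-- A real part is unchanged by conjugation, so a character and its inverse give the same space of
waves. -/
theorem wave_inv (χ : AddChar N Circle) (f : N → M) (z : ℂ) :
    wave χ⁻¹ f z = wave χ f (starRingEnd ℂ z) := by
  simp only [wave_apply]
  refine Finset.sum_congr rfl fun n _ => ?_
  rw [AddChar.inv_apply', ← Complex.conj_re, Circle.coe_inv_eq_conj]
  simp

/-- The wave of an `m`-periodic function vanishes unless the character is trivial on `m`. -/
theorem wave_eq_zero (χ : AddChar N Circle) (f : N → M) (m : N) (hf : ∀ n, f (m + n) = f n)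
    (hm : χ m ≠ 1) (z : ℂ) : wave χ f z = 0 := by
  have hm' : (χ m : ℂ) - 1 ≠ 0 := fun h => hm (Circle.ext (by simpa [sub_eq_zero] using h))
  -- The amplitude is chosen so that the two sides of the shift identity have arguments differing by
  -- `z`.
  have h := wave_shift χ f m (((χ m : ℂ) - 1)⁻¹ * z)
  simp only [hf] at h
  rw [← sub_eq_zero, ← map_sub, ← one_sub_mul, ← mul_assoc, ← neg_sub, neg_mul,
    mul_inv_cancel₀ hm', neg_one_mul, map_neg, neg_eq_zero] at h
  exact h

/-- The Fourier coefficient of a wave at its own character. -/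
theorem wave_self (χ : AddChar N Circle) (h : χ * χ ≠ 1) (z : ℂ) :
    wave χ (fun n => (χ n : ℂ)) z = (Fintype.card N / 2 : ℂ) * z := by
  have h0 : ∑ n, ((χ n : ℂ) * χ n) = 0 := by
    refine AddChar.sum_eq_zero_of_ne_one (ψ := Circle.coeHom.compAddChar (χ * χ)) fun h' => h ?_
    ext n
    exact DFunLike.congr_fun h' n
  -- Of the two halves of the real part, one contributes `z / 2` at every `n`; the other carries `χ
  -- ^ 2`, whose sum is zero.
  have key : ∀ n, ((χ (-n) : ℂ) * z).re • (χ n : ℂ)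
      = z / 2 + ((χ n : ℂ) * χ n) * (starRingEnd ℂ z / 2) := by
    intro n
    have hre : ((((χ (-n) : ℂ) * z).re : ℝ) : ℂ)
        = ((χ (-n) : ℂ) * z + χ n * starRingEnd ℂ z) / 2 := by
      rw [Complex.re_eq_add_conj, map_mul, AddChar.map_neg_eq_inv, ← Circle.coe_inv_eq_conj,
        inv_inv]
    have : (χ n : ℂ) ≠ 0 := Circle.coe_ne_zero _
    rw [Complex.real_smul, hre, AddChar.map_neg_eq_inv, Circle.coe_inv]
    field_simp
  rw [wave_apply, Finset.sum_congr rfl fun n _ => key n, Finset.sum_add_distrib, ← Finset.sum_mul,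
    h0]
  simp
  ring

end Wave

/-! ### Characters of `ℤ/m × ℤ/ℓ` -/

section TorusChar

variable {m ℓ : ℕ} [NeZero m] [NeZero ℓ]

/-- The character `(a, b) ↦ exp (2 * π * I * (r * a / m + s * b / ℓ))`. -/
def torusChar (r : ZMod m) (s : ZMod ℓ) : AddChar (ZMod m × ZMod ℓ) Circle where
  toFun n := ZMod.toCircle (r * n.1) * ZMod.toCircle (s * n.2)
  map_zero_eq_one' := by simp
  map_add_eq_mul' x y := by
    simp only [Prod.fst_add, Prod.snd_add, mul_add, AddChar.map_add_eq_mul]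
    exact mul_mul_mul_comm _ _ _ _

theorem torusChar_apply (r : ZMod m) (s : ZMod ℓ) (n : ZMod m × ZMod ℓ) :
    torusChar r s n = ZMod.toCircle (r * n.1) * ZMod.toCircle (s * n.2) := rfl

theorem torusChar_neg (r : ZMod m) (s : ZMod ℓ) : torusChar (-r) (-s) = (torusChar r s)⁻¹ := by
  ext n
  simp [torusChar_apply, AddChar.map_neg_eq_inv, mul_comm]

theorem torusChar_ne_one {r : ZMod m} (s : ZMod ℓ) (h : r ≠ 0) :
    torusChar r s (1, 0) ≠ 1 := by
  intro h'
  apply h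
  apply ZMod.injective_toCircle
  simpa [torusChar_apply] using h'

theorem torusChar_snd_ne_one (r : ZMod m) {s : ZMod ℓ} (h : s ≠ 0) :
    torusChar r s (0, 1) ≠ 1 := by
  intro h'
  apply h
  apply ZMod.injective_toCircle
  simpa [torusChar_apply] using h'

theorem sum_torusChar (n : ZMod m × ZMod ℓ) :
    ∑ r : ZMod m, ∑ s : ZMod ℓ, (torusChar r s n : ℂ)
      = if n = 0 then (Fintype.card (ZMod m × ZMod ℓ) : ℂ) else 0 := by
  have h1 := AddChar.sum_mulShift n.1 (ZMod.isPrimitive_stdAddChar m)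
  have h2 := AddChar.sum_mulShift n.2 (ZMod.isPrimitive_stdAddChar ℓ)
  simp only [ZMod.stdAddChar_apply] at h1 h2
  simp only [torusChar_apply, Circle.coe_mul]
  rw [← Finset.sum_mul_sum, h1, h2]
  rcases n with ⟨a, b⟩
  by_cases ha : a = 0 <;> by_cases hb : b = 0 <;> simp [ha, hb]

/-- Fourier inversion on `ℤ/m × ℤ/ℓ`, applied to a delta function. -/
theorem sum_wave_torusChar {M : Type*} [AddCommGroup M] [Module ℝ M]
    (f : ZMod m × ZMod ℓ → M) (n : ZMod m × ZMod ℓ) :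
    ∑ r : ZMod m, ∑ s : ZMod ℓ, wave (torusChar r s) f (torusChar r s n)
      = (Fintype.card (ZMod m × ZMod ℓ) : ℝ) • f n := by
  have key : ∀ p : ZMod m × ZMod ℓ,
      ∑ r : ZMod m, ∑ s : ZMod ℓ, ((torusChar r s (-p) : ℂ) * torusChar r s n).re
        = if n = p then (Fintype.card (ZMod m × ZMod ℓ) : ℝ) else 0 := by
    intro p
    have := congrArg Complex.re (sum_torusChar (-p + n))
    simp only [Complex.re_sum, AddChar.map_add_eq_mul, Circle.coe_mul] at this
    rw [this]
    by_cases h : n = p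
    · simp [h]
    · simp [h, neg_add_eq_zero, Ne.symm h]
  simp only [wave_apply]
  rw [Finset.sum_congr rfl fun r _ => Finset.sum_comm, Finset.sum_comm]
  simp only [← Finset.sum_smul, key]
  simp

end TorusChar

/-! ### Coordinates on the 1-cells -/

variable {k ℓ : ℕ}

/-- The 1-cell given by the half-side `plus i j`. -/
def edge (n : ZMod (2 * k) × ZMod ℓ) : Edge k ℓ := Edge.mk (.plus n.1 n.2)

/-- Each `minus` half-side is glued to exactly one `plus` half-side, so the 1-cells are indexed by
`ℤ/2k × ℤ/ℓ`. -/
theorem Edge.mk_minus (i : ZMod (2 * k)) (j : ZMod ℓ) :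
    Edge.mk (.minus i j) = edge (i - 1, j - 1) := by
  have := SideGlue.glue (i - 1) (j - 1)
  rw [sub_add_cancel, sub_add_cancel] at this
  exact (Quot.sound this).symm

/-- The coordinates of a 1-cell. -/
def Edge.coord : Edge k ℓ → ZMod (2 * k) × ZMod ℓ :=
  Quot.lift (fun
    | .plus i j => (i, j)
    | .minus i j => (i - 1, j - 1)) fun _ _ h => by cases h; simp

@[simp]
theorem coord_edge (n : ZMod (2 * k) × ZMod ℓ) : (edge n).coord = n := rfl

@[simp]
theorem edge_coord (e : Edge k ℓ) : edge e.coord = e := by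
  induction e using Quot.ind with
  | mk s =>
    cases s with
    | plus i j => rfl
    | minus i j => exact (Edge.mk_minus i j).symm

theorem smul_edge (a : ZMod (2 * k)) (b : ZMod ℓ) (n : ZMod (2 * k) × ZMod ℓ) :
    (⟨a, b, 1⟩ : SymGroup k ℓ) • edge n = edge ((a, b) + n) :=
  congrArg Edge.mk (by simp [Side.act, Side.shift])

/-- Rewriting the resulting `minus` half-side as a `plus` one costs a shift by `(-1, -1)`; its first
component cancels the `1` in `i ↦ 1 - i`, and only `b - 1` remains. -/
theorem smul_edge_neg (a : ZMod (2 * k)) (b : ZMod ℓ) (n : ZMod (2 * k) × ZMod ℓ) :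
    (⟨a, b, -1⟩ : SymGroup k ℓ) • edge n = edge ((a, b - 1) - n) := by
  have h1 : (-1 : ℤˣ) ≠ 1 := by decide
  have : (⟨a, b, -1⟩ : SymGroup k ℓ) • edge n = Edge.mk (.minus (a + (1 - n.1)) (b + -n.2)) :=
    congrArg Edge.mk (by simp [Side.act, Side.shift, Side.sigma, h1])
  rw [this, Edge.mk_minus]
  congr 1
  ext <;> simp <;> ring

theorem source_edge (n : ZMod (2 * k) × ZMod ℓ) :
    (edge n).source = Vertex.mk (.A n.1 n.2) := rfl

theorem target_edge (n : ZMod (2 * k) × ZMod ℓ) :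
    (edge n).target = Vertex.mk (.M n.1 n.2) := rfl

theorem Vertex.mk_A_shift (n : ZMod (2 * k) × ZMod ℓ) :
    Vertex.mk (.A ((1, 1) + n).1 ((1, 1) + n).2) = Vertex.mk (.A n.1 n.2) := by
  have := Quot.sound (CornerGlue.source (SideGlue.glue n.1 n.2))
  simp only [Side.source] at this
  rw [Prod.fst_add, Prod.snd_add, add_comm, add_comm _ n.2]
  exact this.symm

theorem Vertex.mk_M_shift (n : ZMod (2 * k) × ZMod ℓ) :
    Vertex.mk (.M ((1, 0) + n).1 ((1, 0) + n).2) = Vertex.mk (.M n.1 n.2) := by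
  have := Quot.sound (CornerGlue.target (SideGlue.glue n.1 n.2))
  simp only [Side.target, add_sub_cancel_right] at this
  rw [Prod.fst_add, Prod.snd_add, add_comm, zero_add]
  exact this.symm

/-- Modulo boundaries, this makes the sums of 1-cells over consecutive rows `i - 1` and `i` equal.
-/
theorem faceBoundary_eq (K : Type) [CommRing K] [NeZero ℓ] (i : ZMod (2 * k)) :
    faceBoundary K i = ∑ j : ZMod ℓ,
      ((Finsupp.single (edge (i, j)) 1 : Edge k ℓ →₀ K) - Finsupp.single (edge (i - 1, j)) 1) := by
  refine Finset.sum_congr rfl fun j _ => ?_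
  rw [Edge.mk_minus, add_sub_cancel_right]
  rfl

/-! ### Fourier coefficients of 1-chains -/

section Fourier

/-- The Fourier coefficient of a real 1-chain at a character. -/
def fourierCoeff (χ : AddChar (ZMod (2 * k) × ZMod ℓ) Circle) : (Edge k ℓ →₀ ℝ) →ₗ[ℝ] ℂ :=
  Finsupp.linearCombination ℝ fun e => (χ e.coord : ℂ)

theorem fourierCoeff_single (χ : AddChar (ZMod (2 * k) × ZMod ℓ) Circle)
    (n : ZMod (2 * k) × ZMod ℓ) : fourierCoeff χ (Finsupp.single (edge n) 1) = χ n := by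
  simp [fourierCoeff]

theorem chain_ext {M : Type*} [AddCommGroup M] [Module ℝ M] {f g : (Edge k ℓ →₀ ℝ) →ₗ[ℝ] M}
    (h : ∀ n, f (Finsupp.single (edge n) 1) = g (Finsupp.single (edge n) 1)) : f = g := by
  refine Finsupp.lhom_ext' fun e => LinearMap.ext_ring ?_
  simpa using h e.coord

theorem fourierCoeff_chainRep (χ : AddChar (ZMod (2 * k) × ZMod ℓ) Circle) (a : ZMod (2 * k))
    (b : ZMod ℓ) (x : Edge k ℓ →₀ ℝ) :
    fourierCoeff χ (chainRep k ℓ ℝ ⟨a, b, 1⟩ x) = χ (a, b) * fourierCoeff χ x := by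
  suffices h : fourierCoeff χ ∘ₗ chainRep k ℓ ℝ ⟨a, b, 1⟩
      = LinearMap.mulLeft ℝ (χ (a, b) : ℂ) ∘ₗ fourierCoeff χ from LinearMap.congr_fun h x
  refine chain_ext fun n => ?_
  simp only [LinearMap.comp_apply, chainRep_single, smul_edge, fourierCoeff_single,
    LinearMap.mulLeft_apply, AddChar.map_add_eq_mul, Circle.coe_mul]

/-- The gluing identifies polygon vertices along `(1, 1)`, so such a `χ` descends to a function on
0-cells and the coefficient factors through `boundary₁`. -/
theorem fourierCoeff_eq_zero_of_mem_Z₁ {χ : AddChar (ZMod (2 * k) × ZMod ℓ) Circle}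
    (hχ : χ (1, 1) = 1) {x : Edge k ℓ →₀ ℝ} (hx : x ∈ Z₁ k ℓ ℝ) : fourierCoeff χ x = 0 := by
  -- Edges run from `A` to `M`, so the boundary counts `A` negatively; hence the sign, and the value
  -- zero at midpoints.
  let c : Corner k ℓ → ℂ := fun
    | .A i j => -(χ (i, j) : ℂ)
    | .M _ _ => 0
  have hc : ∀ p q : Corner k ℓ, CornerGlue p q → c p = c q := by
    rintro _ _ (⟨⟨i, j⟩⟩ | ⟨⟨i, j⟩⟩)
    · have : χ (i + 1, j + 1) = χ (i, j) := by
        have := χ.map_add_eq_mul (i, j) (1, 1)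
        rwa [hχ, mul_one] at this
      simp [c, Side.source, this]
    · simp [c, Side.target]
  let φ : (Vertex k ℓ →₀ ℝ) →ₗ[ℝ] ℂ := Finsupp.linearCombination ℝ (Quot.lift c hc)
  have hφ : ∀ p, φ (Finsupp.single (Vertex.mk p) 1) = c p := fun p =>
    (Finsupp.linearCombination_single ℝ _ _).trans (one_smul ℝ _)
  have h : fourierCoeff χ = φ ∘ₗ boundary₁ k ℓ ℝ := by
    refine chain_ext fun n => ?_
    simp only [LinearMap.comp_apply, fourierCoeff_single, boundary₁,
      Finsupp.linearCombination_single, one_smul, map_sub, hφ, source_edge, target_edge]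
    simp [c]
  have hx' : boundary₁ k ℓ ℝ x = 0 := hx
  rw [h, LinearMap.comp_apply, hx', map_zero]

variable [NeZero ℓ]

/-- A face boundary is a difference of full rows, and a character nontrivial on `ℤ/ℓ` sums to zero
over each row. -/
theorem fourierCoeff_eq_zero_of_mem_B₁ {χ : AddChar (ZMod (2 * k) × ZMod ℓ) Circle}
    (hχ : χ (0, 1) ≠ 1) {x : Edge k ℓ →₀ ℝ} (hx : x ∈ B₁ k ℓ ℝ) : fourierCoeff χ x = 0 := by
  obtain ⟨y, rfl⟩ := hx
  suffices h : fourierCoeff χ ∘ₗ boundary₂ k ℓ ℝ = 0 from LinearMap.congr_fun h y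
  refine Finsupp.lhom_ext' fun i => LinearMap.ext_ring ?_
  have h0 : ∑ j : ZMod ℓ, (χ (0, j) : ℂ) = 0 :=
    AddChar.sum_eq_zero_of_ne_one
      (ψ := Circle.coeHom.compAddChar
        (χ.compAddMonoidHom (AddMonoidHom.inr (ZMod (2 * k)) (ZMod ℓ))))
      fun h => hχ (Circle.ext (DFunLike.congr_fun h 1))
  have h1 : ∀ i : ZMod (2 * k), ∑ j : ZMod ℓ, (χ (i, j) : ℂ) = 0 := fun i => by
    have : ∀ j : ZMod ℓ, (χ (i, j) : ℂ) = χ (i, 0) * χ (0, j) := fun j => by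
      rw [← Circle.coe_mul, ← AddChar.map_add_eq_mul]
      simp
    rw [Finset.sum_congr rfl fun j _ => this j, ← Finset.mul_sum, h0, mul_zero]
  simp [boundary₂, faceBoundary_eq, fourierCoeff_single, h1]

variable [NeZero k]

/-- The real 1-chains with Fourier coefficients at `χ` and its inverse only. -/
def edgeWave (χ : AddChar (ZMod (2 * k) × ZMod ℓ) Circle) : ℂ →ₗ[ℝ] (Edge k ℓ →₀ ℝ) :=
  wave χ fun n => Finsupp.single (edge n) 1

/-- Fourier inversion for 1-chains. -/
theorem sum_edgeWave_fourierCoeff (x : Edge k ℓ →₀ ℝ) :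
    ∑ r : ZMod (2 * k), ∑ s : ZMod ℓ, edgeWave (torusChar r s) (fourierCoeff (torusChar r s) x)
      = (Fintype.card (ZMod (2 * k) × ZMod ℓ) : ℝ) • x := by
  suffices h : ∑ r : ZMod (2 * k), ∑ s : ZMod ℓ,
      edgeWave (torusChar r s) ∘ₗ fourierCoeff (torusChar r s)
        = (Fintype.card (ZMod (2 * k) × ZMod ℓ) : ℝ) • LinearMap.id by
    simpa [LinearMap.sum_apply] using LinearMap.congr_fun h x
  refine chain_ext fun n => ?_
  simp only [LinearMap.sum_apply, LinearMap.comp_apply, fourierCoeff_single, edgeWave,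
    sum_wave_torusChar, LinearMap.smul_apply, LinearMap.id_apply]

theorem fourierCoeff_edgeWave {χ : AddChar (ZMod (2 * k) × ZMod ℓ) Circle} (hχ : χ * χ ≠ 1)
    (z : ℂ) : fourierCoeff χ (edgeWave χ z)
      = (Fintype.card (ZMod (2 * k) × ZMod ℓ) / 2 : ℂ) * z := by
  rw [edgeWave, map_wave]
  simp only [fourierCoeff_single]
  exact wave_self χ hχ z

theorem edgeWave_inv (χ : AddChar (ZMod (2 * k) × ZMod ℓ) Circle) (z : ℂ) :
    edgeWave χ⁻¹ z = edgeWave χ (starRingEnd ℂ z) := wave_inv _ _ _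

theorem chainRep_edgeWave (χ : AddChar (ZMod (2 * k) × ZMod ℓ) Circle) (a : ZMod (2 * k))
    (b : ZMod ℓ) (z : ℂ) :
    chainRep k ℓ ℝ ⟨a, b, 1⟩ (edgeWave χ z) = edgeWave χ (χ (a, b) * z) := by
  rw [edgeWave, map_wave, ← wave_shift]
  simp only [chainRep_single, smul_edge]

theorem chainRep_edgeWave_neg (χ : AddChar (ZMod (2 * k) × ZMod ℓ) Circle) (a : ZMod (2 * k))
    (b : ZMod ℓ) (z : ℂ) :
    chainRep k ℓ ℝ ⟨a, b, -1⟩ (edgeWave χ z)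
      = edgeWave χ (χ (a, b - 1) * starRingEnd ℂ z) := by
  rw [edgeWave, map_wave, ← wave_shift, ← wave_neg]
  simp only [chainRep_single, smul_edge_neg, sub_eq_add_neg]

/-- The terminal points of the edges are `(1, 0)`-periodic and the initial points `(1, 1)`-periodic,
so `wave_eq_zero` kills both halves of the boundary. -/
theorem edgeWave_mem_Z₁ {χ : AddChar (ZMod (2 * k) × ZMod ℓ) Circle} (h0 : χ (1, 0) ≠ 1)
    (h1 : χ (1, 1) ≠ 1) (z : ℂ) : edgeWave χ z ∈ Z₁ k ℓ ℝ := by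
  change boundary₁ k ℓ ℝ (edgeWave χ z) = 0
  rw [edgeWave, map_wave]
  simp only [boundary₁, Finsupp.linearCombination_single, one_smul, source_edge, target_edge]
  rw [wave_sub, wave_eq_zero χ _ (1, 0) (fun n => by rw [Vertex.mk_M_shift]) h0,
    wave_eq_zero χ _ (1, 1) (fun n => by rw [Vertex.mk_A_shift]) h1, sub_zero]

/-- Since `χ` is trivial on `ℤ/ℓ`, `ℓ` times this wave is the wave of the row sums. Modulo
boundaries all row sums agree, so that wave is `(1, 0)`-periodic and vanishes. -/
theorem edgeWave_mem_B₁ {χ : AddChar (ZMod (2 * k) × ZMod ℓ) Circle} (h0 : χ (1, 0) ≠ 1)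
    (h1 : ∀ j, χ (0, j) = 1) (z : ℂ) : edgeWave χ z ∈ B₁ k ℓ ℝ := by
  let E : ZMod (2 * k) × ZMod ℓ → (Edge k ℓ →₀ ℝ) ⧸ B₁ k ℓ ℝ :=
    fun n => (B₁ k ℓ ℝ).mkQ (Finsupp.single (edge n) 1)
  have hE : ∀ i : ZMod (2 * k), ∑ j, E (1 + i, j) = ∑ j, E (i, j) := fun i => by
    have : (B₁ k ℓ ℝ).mkQ (faceBoundary ℝ (1 + i)) = 0 :=
      (Submodule.Quotient.mk_eq_zero _).2 ⟨Finsupp.single (1 + i) 1, by simp [boundary₂]⟩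
    rw [faceBoundary_eq, map_sum] at this
    simp only [map_sub, Finset.sum_sub_distrib, sub_eq_zero, add_sub_cancel_left] at this
    exact this
  have h2 : wave χ (fun n => ∑ j, E ((0, j) + n)) z = 0 := by
    refine wave_eq_zero χ _ (1, 0) (fun n => ?_) h0 z
    have : ∀ i : ZMod (2 * k), ∑ j, E ((0, j) + (i, n.2)) = ∑ j, E (i, j) := fun i => by
      simp only [Prod.mk_add_mk, zero_add]
      exact Equiv.sum_comp (Equiv.addRight n.2) fun j => E (i, j)
    rw [show (1, 0) + n = (1 + n.1, n.2) by ext <;> simp, this, hE, ← this]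
  rw [wave_sum] at h2
  simp only [wave_shift χ E, h1, Circle.coe_one, one_mul, Finset.sum_const, Finset.card_univ,
    ← Nat.cast_smul_eq_nsmul ℝ] at h2
  have h3 : wave χ E z = 0 := (smul_eq_zero.1 h2).resolve_left (by simp [NeZero.ne ℓ])
  rw [← Submodule.Quotient.mk_eq_zero, ← Submodule.mkQ_apply, edgeWave, map_wave]
  exact h3

end Fourier

/-! ### The sum of the translation by one and its inverse, on homology -/

variable (k ℓ) in
/-- The sum of the actions of the generator of `ℤ/2k` and of its inverse on homology. -/
def angleOp (K : Type) [CommRing K] [NeZero ℓ] : H₁ k ℓ K →ₗ[K] H₁ k ℓ K :=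
  homologyRep k ℓ K ⟨1, 0, 1⟩ + homologyRep k ℓ K ⟨-1, 0, 1⟩

/-- Translations commute, and conjugation by `σ` only exchanges the two terms of the sum. -/
theorem angleOp_homologyRep (K : Type) [CommRing K] [NeZero ℓ] (g : SymGroup k ℓ)
    (v : H₁ k ℓ K) :
    angleOp k ℓ K (homologyRep k ℓ K g v) = homologyRep k ℓ K g (angleOp k ℓ K v) := by
  obtain ⟨a, b, ε⟩ := g
  simp only [angleOp, LinearMap.add_apply, map_add, ← Module.End.mul_apply, ← map_mul,
    SymGroup.mul_def]
  rcases Int.units_eq_one_or ε with rfl | rfl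
  · simp [add_comm]
  · simp only [Units.neg_smul, one_smul, smul_neg, smul_zero,
      add_zero, zero_add, neg_neg, one_mul, mul_one]
    rw [add_comm, add_comm a, add_comm a]

section Summands

variable [NeZero k] [NeZero ℓ]

/-! ### The planes spanned by waves in homology -/

/-- The homology classes of waves. -/
def homologyWave (χ : AddChar (ZMod (2 * k) × ZMod ℓ) Circle) (h0 : χ (1, 0) ≠ 1)
    (h1 : χ (1, 1) ≠ 1) : ℂ →ₗ[ℝ] H₁ k ℓ ℝ :=
  ((B₁ k ℓ ℝ).mkQ ∘ₗ edgeWave χ).codRestrict (H₁ k ℓ ℝ) fun z =>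
    ⟨_, edgeWave_mem_Z₁ h0 h1 z, rfl⟩

section HomologyWave

variable {χ : AddChar (ZMod (2 * k) × ZMod ℓ) Circle} (h0 : χ (1, 0) ≠ 1) (h1 : χ (1, 1) ≠ 1)

theorem homologyRep_homologyWave (a : ZMod (2 * k)) (b : ZMod ℓ) (z : ℂ) :
    homologyRep k ℓ ℝ ⟨a, b, 1⟩ (homologyWave χ h0 h1 z)
      = homologyWave χ h0 h1 (χ (a, b) * z) :=
  Subtype.ext (congrArg (B₁ k ℓ ℝ).mkQ (chainRep_edgeWave χ a b z))

theorem homologyRep_homologyWave_neg (a : ZMod (2 * k)) (b : ZMod ℓ) (z : ℂ) :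
    homologyRep k ℓ ℝ ⟨a, b, -1⟩ (homologyWave χ h0 h1 z)
      = homologyWave χ h0 h1 (χ (a, b - 1) * starRingEnd ℂ z) :=
  Subtype.ext (congrArg (B₁ k ℓ ℝ).mkQ (chainRep_edgeWave_neg χ a b z))

theorem homologyWave_injective (h2 : χ (0, 1) ≠ 1) (h3 : χ * χ ≠ 1) :
    Function.Injective (homologyWave χ h0 h1) := by
  rw [← LinearMap.ker_eq_bot, LinearMap.ker_eq_bot']
  intro z hz
  have hB : edgeWave χ z ∈ B₁ k ℓ ℝ :=
    (Submodule.Quotient.mk_eq_zero _).1 (congrArg Subtype.val hz)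
  have := fourierCoeff_eq_zero_of_mem_B₁ h2 hB
  rw [fourierCoeff_edgeWave h3, mul_eq_zero] at this
  exact this.resolve_left (by simp [NeZero.ne ℓ, NeZero.ne k])

end HomologyWave

theorem planeRep_one (r : ZMod (2 * k)) (s : ZMod ℓ) (a : ZMod (2 * k)) (b : ZMod ℓ) (z : ℂ) :
    planeRep r s ⟨a, b, 1⟩ z = torusChar r s (a, b) * z := by
  simp [planeRep, rotation, torusChar_apply, mul_assoc]

theorem planeRep_neg_one (r : ZMod (2 * k)) (s : ZMod ℓ) (a : ZMod (2 * k)) (b : ZMod ℓ) (z : ℂ) :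
    planeRep r s ⟨a, b, -1⟩ z = torusChar r s (a, b) * -starRingEnd ℂ z := by
  have h1 : (-1 : ℤˣ) ≠ 1 := by decide
  simp [planeRep, rotation, torusChar_apply, h1, reflection_apply, mul_assoc]

/-- The plane of homology classes of waves for the character of parameters `r, s` is isomorphic
to `π_{r,s}`. -/
theorem exists_subrepresentation_equiv_planeRep {r : ZMod (2 * k)} {s : ZMod ℓ}
    (h0 : torusChar r s (1, 0) ≠ 1) (h1 : torusChar r s (1, 1) ≠ 1)
    (h2 : torusChar r s (0, 1) ≠ 1) (h3 : torusChar r s * torusChar r s ≠ 1) :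
    ∃ V : Subrepresentation (homologyRep k ℓ ℝ),
      Nonempty (V.toRepresentation.Equiv (planeRep r s)) ∧
        ∀ z, homologyWave (torusChar r s) h0 h1 z ∈ V.toSubmodule := by
  set χ := torusChar r s with hχ
  -- `σ` acts on amplitudes by `z ↦ χ (0, -1) * conj z` but on `π_{r,s}` by `z ↦ -conj z`. Rotation
  -- by `u` intertwines the two when `u ^ 2 = -χ (0, -1)`.
  obtain ⟨u, hu⟩ := IsAlgClosed.exists_pow_nat_eq (-(χ (0, -1) : ℂ)) zero_lt_two
  have hnorm : ‖u‖ = 1 := by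
    have := congrArg norm hu
    rw [norm_pow, norm_neg, Circle.norm_coe] at this
    exact (pow_eq_one_iff_of_nonneg (norm_nonneg _) two_ne_zero).1 this
  have hu0 : u ≠ 0 := norm_ne_zero_iff.1 (by simp [hnorm])
  have huu : u * starRingEnd ℂ u = 1 := by simp [Complex.mul_conj', hnorm]
  have hconj : -u = χ (0, -1) * starRingEnd ℂ u := by
    linear_combination u * huu - (starRingEnd ℂ u) * hu
  let Ψ : ℂ →ₗ[ℝ] H₁ k ℓ ℝ := homologyWave χ h0 h1 ∘ₗ LinearMap.mulLeft ℝ u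
  have hΨ : ∀ g z, Ψ (planeRep r s g z) = homologyRep k ℓ ℝ g (Ψ z) := by
    rintro ⟨a, b, ε⟩ z
    rcases Int.units_eq_one_or ε with rfl | rfl
    · simp only [Ψ, LinearMap.comp_apply, LinearMap.mulLeft_apply, homologyRep_homologyWave,
        planeRep_one, ← hχ]
      congr 1
      ring
    · simp only [Ψ, LinearMap.comp_apply, LinearMap.mulLeft_apply, homologyRep_homologyWave_neg,
        planeRep_neg_one, ← hχ]
      congr 1
      have : (χ (a, b - 1) : ℂ) = χ (a, b) * χ (0, -1) := by
        rw [← Circle.coe_mul, ← AddChar.map_add_eq_mul, Prod.mk_add_mk, add_zero, sub_eq_add_neg]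
      rw [this, map_mul]
      linear_combination χ (a, b) * starRingEnd ℂ z * hconj
  have hinj : Function.Injective Ψ :=
    (homologyWave_injective h0 h1 h2 h3).comp (mul_right_injective₀ hu0)
  let V : Subrepresentation (homologyRep k ℓ ℝ) := ⟨LinearMap.range Ψ, by
    rintro g _ ⟨z, rfl⟩
    exact ⟨_, hΨ g z⟩⟩
  let e : (planeRep r s).Equiv V.toRepresentation :=
    .mk (LinearEquiv.ofInjective Ψ hinj) fun g => LinearMap.ext fun z => Subtype.ext (hΨ g z)
  exact ⟨V, ⟨e.symm⟩, fun z => ⟨u⁻¹ * z,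
    congrArg (homologyWave χ h0 h1) (mul_inv_cancel_left₀ hu0 z)⟩⟩

/-! ### The indices of the summands -/

theorem natCast_zmod_ne_zero {N n : ℕ} (h0 : 0 < n) (h : n < N) : (n : ZMod N) ≠ 0 := fun h' =>
  absurd (Nat.le_of_dvd h0 ((ZMod.natCast_eq_zero_iff n N).1 h')) (not_le.2 h)

theorem torusChar_one_one_eq_one_iff (r s : ℕ) :
    torusChar (r : ZMod (2 * k)) (s : ZMod ℓ) (1, 1) = 1 ↔
      ∃ n : ℤ, (r : ℚ) / (2 * k) + (s : ℚ) / ℓ = n := by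
  rw [← Circle.coe_inj, torusChar_apply, Circle.coe_mul, mul_one, mul_one, ZMod.toCircle_natCast,
    ZMod.toCircle_natCast, ← Complex.exp_add, Circle.coe_one, Complex.exp_eq_one_iff]
  refine exists_congr fun n => ?_
  have hpi := Complex.two_pi_I_ne_zero
  rw [← Rat.cast_inj (α := ℂ)]
  push_cast
  constructor <;> intro h
  · exact mul_left_cancel₀ hpi (by linear_combination h)
  · linear_combination (2 * Real.pi * Complex.I) * h

theorem torusChar_mul_self (r : ZMod (2 * k)) (s : ZMod ℓ) :
    torusChar r s * torusChar r s = torusChar (2 * r) (2 * s) := by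
  ext n
  simp [torusChar_apply, two_mul, add_mul, AddChar.map_add_eq_mul]
  ring

section SummandIndex

variable {r s : ℕ} (hr : 0 < r) (hrk : r ≤ k)
include hr hrk

omit [NeZero k] in
theorem natCast_ne_zero_of_le : (r : ZMod (2 * k)) ≠ 0 := natCast_zmod_ne_zero hr (by omega)

/-- The sum `r / 2k + s / ℓ` lies strictly between 0 and 2, so `χ (1, 1) = 1` could only come from
the value 1. For `r < k` the square of `χ` is nontrivial on `ℤ/2k`; for `r = k` this fails, and `2 *
s < ℓ` makes it nontrivial on `ℤ/ℓ`. -/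
theorem IsSummandIndex.character_conditions (h : IsSummandIndex k ℓ r s) :
    (s : ZMod ℓ) ≠ 0 ∧ torusChar (r : ZMod (2 * k)) (s : ZMod ℓ) (1, 1) ≠ 1 ∧
      torusChar (r : ZMod (2 * k)) (s : ZMod ℓ) * torusChar (r : ZMod (2 * k)) (s : ZMod ℓ)
        ≠ 1 := by
  have hk : (0 : ℚ) < k := Nat.cast_pos.2 (NeZero.pos k)
  have hl : (0 : ℚ) < ℓ := Nat.cast_pos.2 (NeZero.pos ℓ)
  have hr' : (0 : ℚ) < r := Nat.cast_pos.2 hr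
  have hrk' : (r : ℚ) ≤ k := Nat.cast_le.2 hrk
  have hs0 : 0 < s := by rcases h with h | h <;> exact h.2.1
  have hs0' : (0 : ℚ) < s := Nat.cast_pos.2 hs0
  have h1 : (r : ℚ) / (2 * k) ≤ 1 / 2 := by rw [div_le_div_iff₀ (by positivity) two_pos]; linarith
  have h1' : 0 < (r : ℚ) / (2 * k) := by positivity
  have h2 : 0 < (s : ℚ) / ℓ := by positivity
  have hsl : s < ℓ := by
    rcases h with h | h
    · exact h.2.2.1
    · rw [← Nat.cast_lt (α := ℚ)]; linarith [h.2.2]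
  have h3 : (s : ℚ) / ℓ < 1 := (div_lt_one hl).2 (Nat.cast_lt.2 hsl)
  refine ⟨natCast_zmod_ne_zero hs0 hsl, fun h' => ?_, fun h' => ?_⟩
  · obtain ⟨n, hn⟩ := (torusChar_one_one_eq_one_iff r s).1 h'
    have hn0 : 0 < n := by rw [← Int.cast_pos (R := ℚ)]; linarith
    have hn2 : n < 2 := by
      rw [← Int.cast_lt (R := ℚ)]
      push_cast
      linarith
    obtain rfl : n = 1 := by omega
    rcases h with h | h
    · exact h.2.2.2 (by simpa using hn)
    · have : (s : ℚ) / ℓ < 1 / 2 := by rw [div_lt_div_iff₀ hl two_pos]; linarith [h.2.2]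
      push_cast at hn
      linarith
  · rw [torusChar_mul_self] at h'
    rcases h with h | h
    · refine torusChar_ne_one (2 * (s : ZMod ℓ)) (r := 2 * (r : ZMod (2 * k))) ?_
        (by rw [h']; rfl)
      exact_mod_cast natCast_zmod_ne_zero (n := 2 * r) (N := 2 * k) (by omega) (by omega)
    · refine torusChar_snd_ne_one (2 * (r : ZMod (2 * k))) (s := 2 * (s : ZMod ℓ)) ?_
        (by rw [h']; rfl)
      have : 2 * s < ℓ := by
        rw [← Nat.cast_lt (α := ℚ)]
        push_cast
        linarith [h.2.2]
      exact_mod_cast natCast_zmod_ne_zero (n := 2 * s) (N := ℓ) (by omega) this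

-- When `r = k`, `r = -r` modulo `2k`, so `s` and `-s` give inverse characters and the same waves;
-- one of them is below `ℓ / 2`. The case `s = ℓ / 2` is excluded because then `χ (1, 1) = 1`.
omit hr in
theorem isSummandIndex_or {s : ZMod ℓ} (hs : s ≠ 0)
    (h : torusChar (r : ZMod (2 * k)) s (1, 1) ≠ 1) :
    IsSummandIndex k ℓ r s.val ∨ (r = k ∧ IsSummandIndex k ℓ r (-s).val) := by
  have hk : (0 : ℚ) < k := Nat.cast_pos.2 (NeZero.pos k)
  have hl : (0 : ℚ) < ℓ := Nat.cast_pos.2 (NeZero.pos ℓ)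
  have hs0 : 0 < s.val := Nat.pos_of_ne_zero (by simpa using hs)
  have hsl : s.val < ℓ := ZMod.val_lt s
  have h1 : (r : ℚ) / (2 * k) + (s.val : ℚ) / ℓ ≠ 1 := fun h' => by
    refine h ?_
    have := (torusChar_one_one_eq_one_iff (k := k) (ℓ := ℓ) r s.val).2 ⟨1, by simpa using h'⟩
    rwa [ZMod.natCast_zmod_val] at this
  rcases hrk.lt_or_eq with hlt | rfl
  · exact .inl (.inl ⟨hlt, hs0, hsl, h1⟩)
  · rcases lt_trichotomy (s.val : ℚ) (ℓ / 2) with h2 | h2 | h2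
    · exact .inl (.inr ⟨rfl, hs0, h2⟩)
    · refine absurd ?_ h1
      rw [h2]
      field_simp
      norm_num
    · refine .inr ⟨rfl, .inr ⟨rfl, ?_⟩⟩
      have : NeZero s := ⟨hs⟩
      rw [ZMod.val_neg_of_ne_zero, Nat.cast_sub hsl.le]
      exact ⟨by omega, by linarith⟩

/-! ### The subrepresentation `H_r` -/

theorem IsSummandIndex.exists_isSummand (h : IsSummandIndex k ℓ r s) :
    ∃ V, IsSummand k ℓ r V ∧
      ∀ z, (B₁ k ℓ ℝ).mkQ (edgeWave (torusChar (r : ZMod (2 * k)) (s : ZMod ℓ)) z) ∈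
        V.toSubmodule.map (H₁ k ℓ ℝ).subtype := by
  obtain ⟨h2, h1, h3⟩ := h.character_conditions hr hrk
  obtain ⟨V, hV, hz⟩ := exists_subrepresentation_equiv_planeRep
    (torusChar_ne_one _ (natCast_ne_zero_of_le hr hrk)) h1 (torusChar_snd_ne_one _ h2) h3
  exact ⟨V, ⟨s, h, hV⟩, fun z => ⟨_, hz z, rfl⟩⟩

omit hr hrk in
theorem IsSummand.le_Hr {V : Subrepresentation (homologyRep k ℓ ℝ)} (h : IsSummand k ℓ r V) :
    V.toSubmodule ≤ (Hr k ℓ r).toSubmodule :=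
  le_iSup (fun V : {V // IsSummand k ℓ r V} => V.1.toSubmodule) ⟨V, h⟩

theorem mkQ_edgeWave_mem_Hr {s : ZMod ℓ} (hs : s ≠ 0)
    (h : torusChar (r : ZMod (2 * k)) s (1, 1) ≠ 1) (z : ℂ) :
    (B₁ k ℓ ℝ).mkQ (edgeWave (torusChar (r : ZMod (2 * k)) s) z) ∈
      (Hr k ℓ r).toSubmodule.map (H₁ k ℓ ℝ).subtype := by
  rcases isSummandIndex_or hrk hs h with h | ⟨rfl, h⟩
  · obtain ⟨V, hV, hz⟩ := h.exists_isSummand hr hrk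
    rw [ZMod.natCast_zmod_val] at hz
    exact Submodule.map_mono hV.le_Hr (hz z)
  · obtain ⟨V, hV, hz⟩ := h.exists_isSummand hr hrk
    rw [ZMod.natCast_zmod_val] at hz
    have hneg : (r : ZMod (2 * r)) = -(r : ZMod (2 * r)) := by
      rw [eq_neg_iff_add_eq_zero]
      exact_mod_cast (ZMod.natCast_eq_zero_iff (r + r) (2 * r)).2 (by rw [two_mul])
    have : torusChar (r : ZMod (2 * r)) s = (torusChar (r : ZMod (2 * r)) (-s))⁻¹ := by
      rw [← torusChar_neg, neg_neg, ← hneg]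
    rw [this, edgeWave_inv]
    exact Submodule.map_mono hV.le_Hr (hz _)

theorem Hr_ne_bot (hℓ : 3 ≤ ℓ) : (Hr k ℓ r).toSubmodule ≠ ⊥ := by
  obtain ⟨s, hs⟩ : ∃ s, IsSummandIndex k ℓ r s := by
    have hl : (3 : ℚ) ≤ ℓ := by exact_mod_cast hℓ
    rcases hrk.lt_or_eq with hlt | rfl
    · by_cases h : (r : ℚ) / (2 * k) + (1 : ℕ) / ℓ = 1
      · refine ⟨2, .inl ⟨hlt, two_pos, by omega, fun h' => ?_⟩⟩
        have : (0 : ℚ) < 1 / ℓ := by positivity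
        have h2 : ((2 : ℕ) : ℚ) / ℓ = 1 / ℓ + 1 / ℓ := by push_cast; ring
        rw [h2] at h'
        push_cast at h
        linarith
      · exact ⟨1, .inl ⟨hlt, one_pos, by omega, h⟩⟩
    · exact ⟨1, .inr ⟨rfl, one_pos, by push_cast; linarith⟩⟩
  intro hbot
  obtain ⟨V, hV, -⟩ := hs.exists_isSummand hr hrk
  obtain ⟨_, _, ⟨e⟩⟩ := id hV
  have h1 : (e.symm 1 : H₁ k ℓ ℝ) = 0 := by
    rw [← Submodule.mem_bot ℝ, ← hbot]
    exact hV.le_Hr (e.symm 1).2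
  have h2 : e.symm 1 = 0 := Subtype.ext h1
  have := congrArg e h2
  rw [Representation.Equiv.apply_symm_apply, map_zero] at this
  exact one_ne_zero this

end SummandIndex

/-! ### `H_r` as an eigenspace of `angleOp` -/

/-- The sum `2 * cos (π * r / k)` of the eigenvalues of the rotation of angle `π * r / k`. -/
def angleTrace (r : ZMod (2 * k)) : ℝ := 2 * (ZMod.toCircle r : ℂ).re

theorem toCircle_add_toCircle_neg (r : ZMod (2 * k)) :
    (ZMod.toCircle r : ℂ) + ZMod.toCircle (-r) = angleTrace r := by
  rw [AddChar.map_neg_eq_inv, Circle.coe_inv_eq_conj, Complex.add_conj]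
  rfl

theorem angleTrace_eq_iff {r r' : ZMod (2 * k)} :
    angleTrace r' = angleTrace r ↔ r' = r ∨ r' = -r := by
  rw [← Complex.ofReal_inj, ← toCircle_add_toCircle_neg, ← toCircle_add_toCircle_neg]
  constructor
  · intro h
    rw [AddChar.map_neg_eq_inv, AddChar.map_neg_eq_inv, Circle.coe_inv, Circle.coe_inv] at h
    have h1 : (ZMod.toCircle r : ℂ) ≠ 0 := Circle.coe_ne_zero _
    have h2 : (ZMod.toCircle r' : ℂ) ≠ 0 := Circle.coe_ne_zero _
    field_simp at h
    -- The equation `x + x⁻¹ = y + y⁻¹` factors as `(x - y) * (x * y - 1) = 0`.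
    have : ((ZMod.toCircle r' : ℂ) - ZMod.toCircle r)
        * (ZMod.toCircle r' * ZMod.toCircle r - 1) = 0 := by
      linear_combination h
    rcases mul_eq_zero.1 this with h | h
    · exact .inl (ZMod.injective_toCircle (Circle.ext (sub_eq_zero.1 h)))
    · right
      apply ZMod.injective_toCircle
      rw [AddChar.map_neg_eq_inv, eq_inv_iff_mul_eq_one]
      exact Circle.ext (sub_eq_zero.1 h)
  · rintro (rfl | rfl)
    · rfl
    · rw [neg_neg, add_comm]

theorem angleOp_of_mem_Hr {r : ℕ} {v : H₁ k ℓ ℝ} (hv : v ∈ (Hr k ℓ r).toSubmodule) :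
    angleOp k ℓ ℝ v = angleTrace (r : ZMod (2 * k)) • v := by
  suffices h : (Hr k ℓ r).toSubmodule
      ≤ LinearMap.ker (angleOp k ℓ ℝ - angleTrace (r : ZMod (2 * k)) • LinearMap.id) by
    simpa [sub_eq_zero] using h hv
  refine iSup_le fun ⟨V, s, hs, ⟨e⟩⟩ v hv => ?_
  have he : ∀ g z, V.toRepresentation g (e.symm z) = e.symm (planeRep _ _ g z) := fun g z =>
    (LinearMap.congr_fun (e.symm.isIntertwining' g) z).symm
  obtain ⟨z, hz⟩ : ∃ z, e.symm z = ⟨v, hv⟩ := ⟨e ⟨v, hv⟩, e.symm_apply_apply _⟩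
  have h : V.toRepresentation ⟨1, 0, 1⟩ ⟨v, hv⟩ + V.toRepresentation ⟨-1, 0, 1⟩ ⟨v, hv⟩
      = angleTrace (r : ZMod (2 * k)) • ⟨v, hv⟩ := by
    rw [← hz, he, he, ← map_add, ← map_smul, planeRep_one, planeRep_one, ← add_mul]
    congr 1
    simp [torusChar_apply, toCircle_add_toCircle_neg]
  have h' := congrArg Subtype.val h
  rw [LinearMap.mem_ker, LinearMap.sub_apply, sub_eq_zero]
  exact h'

/-- The subrepresentation `H_r` is an eigenspace of `angleOp`. -/
theorem mem_Hr_of_angleOp {r : ℕ} (hr : 0 < r) (hrk : r ≤ k) {v : H₁ k ℓ ℝ}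
    (hv : angleOp k ℓ ℝ v = angleTrace (r : ZMod (2 * k)) • v) :
    v ∈ (Hr k ℓ r).toSubmodule := by
  obtain ⟨_, x, hx, rfl⟩ := v
  have hB : chainRep k ℓ ℝ ⟨1, 0, 1⟩ x + chainRep k ℓ ℝ ⟨-1, 0, 1⟩ x
      - angleTrace (r : ZMod (2 * k)) • x ∈ B₁ k ℓ ℝ := by
    rw [← Submodule.Quotient.mk_eq_zero, Submodule.Quotient.mk_sub, sub_eq_zero]
    exact congrArg Subtype.val hv
  -- The eigenvalue equation holds only modulo boundaries, but boundaries have no coefficient at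
  -- these characters.
  have hcoeff : ∀ r' : ZMod (2 * k), ∀ s' : ZMod ℓ, s' ≠ 0 → r' ≠ r → r' ≠ -r →
      fourierCoeff (torusChar r' s') x = 0 := by
    intro r' s' hs' h1 h2
    have h := fourierCoeff_eq_zero_of_mem_B₁ (torusChar_snd_ne_one r' hs') hB
    rw [map_sub, map_add, fourierCoeff_chainRep, fourierCoeff_chainRep, map_smul, ← add_mul,
      Complex.real_smul, ← sub_mul, mul_eq_zero] at h
    refine h.resolve_left fun h => ?_
    simp only [torusChar_apply, mul_one, mul_zero, AddChar.map_zero_eq_one, mul_neg,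
      toCircle_add_toCircle_neg, sub_eq_zero, Complex.ofReal_inj, angleTrace_eq_iff] at h
    exact h.elim h1 h2
  -- Each Fourier component vanishes, is a boundary, or is a wave already known to lie in `H_r`;
  -- Fourier inversion then recovers a nonzero multiple of `x`.
  have hmem : ∀ r' : ZMod (2 * k), ∀ s' : ZMod ℓ,
      (B₁ k ℓ ℝ).mkQ (edgeWave (torusChar r' s') (fourierCoeff (torusChar r' s') x)) ∈
        (Hr k ℓ r).toSubmodule.map (H₁ k ℓ ℝ).subtype := by
    intro r' s'
    by_cases h1 : torusChar r' s' (1, 1) = 1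
    · rw [fourierCoeff_eq_zero_of_mem_Z₁ h1 hx, map_zero, map_zero]
      exact Submodule.zero_mem _
    by_cases hs' : s' = 0
    · subst hs'
      have hr' : r' ≠ 0 := by
        rintro rfl
        exact h1 (by simp [torusChar_apply])
      have h := edgeWave_mem_B₁ (torusChar_ne_one (0 : ZMod ℓ) hr')
        (fun j => by simp [torusChar_apply]) (fourierCoeff (torusChar r' 0) x)
      rw [Submodule.mkQ_apply, (Submodule.Quotient.mk_eq_zero _).2 h]
      exact Submodule.zero_mem _
    by_cases h2 : r' = r
    · subst h2
      exact mkQ_edgeWave_mem_Hr hr hrk hs' h1 _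
    by_cases h3 : r' = -r
    · subst h3
      have : torusChar (-(r : ZMod (2 * k))) s' = (torusChar (r : ZMod (2 * k)) (-s'))⁻¹ := by
        rw [← torusChar_neg, neg_neg]
      rw [this] at h1 ⊢
      rw [edgeWave_inv]
      exact mkQ_edgeWave_mem_Hr hr hrk (neg_ne_zero.2 hs')
        (fun h => h1 (by rw [AddChar.inv_apply', h, inv_one])) _
    · rw [hcoeff r' s' hs' h2 h3, map_zero, map_zero]
      exact Submodule.zero_mem _
  have hsum := Submodule.sum_mem _ fun r' (_ : r' ∈ Finset.univ) =>
    Submodule.sum_mem _ fun s' (_ : s' ∈ Finset.univ) => hmem r' s'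
  simp only [← map_sum] at hsum
  rw [sum_edgeWave_fourierCoeff, map_smul] at hsum
  rw [Submodule.smul_mem_iff _ (by simp [NeZero.ne ℓ, NeZero.ne k])] at hsum
  obtain ⟨w, hw, hwx⟩ := hsum
  have : w = ⟨(B₁ k ℓ ℝ).mkQ x, ⟨x, hx, rfl⟩⟩ := Subtype.ext hwx
  rwa [← this]

end Summands

/-- An element of `ℝ ⊗ V` vanishes if it is killed by all `ℚ`-linear functionals on `ℝ`. -/
theorem eq_zero_of_forall_rTensor_eq_zero {V : Type*} [AddCommGroup V] [Module ℚ V]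
    {x : ℝ ⊗[ℚ] V} (h : ∀ f : ℝ →ₗ[ℚ] ℚ, TensorProduct.lid ℚ V (f.rTensor V x) = 0) : x = 0 := by
  let b := Module.Free.chooseBasis ℚ ℝ
  apply (TensorProduct.equivFinsuppOfBasisLeft b).injective
  rw [map_zero]
  ext i
  rw [TensorProduct.equivFinsuppOfBasisLeft_apply, h, Finsupp.zero_apply]

/-! ### Rational coordinates of real homology classes -/

section Coord

variable (f : ℝ →ₗ[ℚ] ℚ)

/-- The map from real chains to rational chains that applies a `ℚ`-linear functional to every
coefficient. -/
def chainCoord (X : Type) : (X →₀ ℝ) →ₗ[ℚ] (X →₀ ℚ) := Finsupp.mapRange.linearMap f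

theorem chainCoord_single {X : Type} (e : X) (c : ℝ) :
    chainCoord f X (Finsupp.single e c) = Finsupp.single e (f c) := by
  simp [chainCoord]

theorem chainCoord_smul_chainExt {X : Type} (c : ℝ) (x : X →₀ ℚ) :
    chainCoord f X (c • chainExt X x) = f c • x := by
  ext e
  have : c * ((x e : ℚ) : ℝ) = x e • c := by rw [Rat.smul_def, mul_comm]
  simp [chainCoord, chainExt, this, mul_comm]

theorem exists_sum_smul_chainExt {X ι : Type} (b : Module.Basis ι ℚ ℝ) (x : X →₀ ℝ) :
    ∃ t : Finset ι, ∑ i ∈ t, b i • chainExt X (chainCoord (b.coord i) X x) = x := by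
  classical
  refine ⟨x.support.biUnion fun e => (b.repr (x e)).support, Finsupp.ext fun e => ?_⟩
  have h := b.linearCombination_repr (x e)
  by_cases he : x e = 0
  · simp [chainExt, chainCoord, he]
  · rw [Finsupp.linearCombination_apply, Finsupp.sum_of_support_subset _
      (Finset.subset_biUnion_of_mem (fun e => (b.repr (x e)).support)
        (Finsupp.mem_support_iff.2 he)) _ (by simp)] at h
    conv_rhs => rw [← h]
    simp [Finsupp.finsetSum_apply, chainExt, chainCoord, Rat.smul_def, mul_comm]

theorem boundary₁_chainCoord (x : Edge k ℓ →₀ ℝ) :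
    boundary₁ k ℓ ℚ (chainCoord f _ x) = chainCoord f _ (boundary₁ k ℓ ℝ x) := by
  induction x using Finsupp.induction_linear with
  | zero => simp
  | add x y hx hy => simp only [map_add, hx, hy]
  | single e c =>
    simp only [chainCoord_single, boundary₁, Finsupp.linearCombination_single, smul_sub,
      Finsupp.smul_single, smul_eq_mul, mul_one, map_sub]

theorem chainRep_chainCoord (g : SymGroup k ℓ) (x : Edge k ℓ →₀ ℝ) :
    chainRep k ℓ ℚ g (chainCoord f _ x) = chainCoord f _ (chainRep k ℓ ℝ g x) := by
  induction x using Finsupp.induction_linear with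
  | zero => simp
  | add x y hx hy => simp only [map_add, hx, hy]
  | single e c => simp only [chainCoord_single, chainRep_single]

theorem chainRep_chainExt (g : SymGroup k ℓ) (x : Edge k ℓ →₀ ℚ) :
    chainRep k ℓ ℝ g (chainExt _ x) = chainExt _ (chainRep k ℓ ℚ g x) := by
  induction x using Finsupp.induction_linear with
  | zero => simp
  | add x y hx hy => simp only [map_add, hx, hy]
  | single e c => simp only [chainExt_single, chainRep_single]

variable [NeZero ℓ]

theorem boundary₂_chainCoord (x : ZMod (2 * k) →₀ ℝ) :
    boundary₂ k ℓ ℚ (chainCoord f _ x) = chainCoord f _ (boundary₂ k ℓ ℝ x) := by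
  induction x using Finsupp.induction_linear with
  | zero => simp
  | add x y hx hy => simp only [map_add, hx, hy]
  | single i c =>
    simp only [chainCoord_single, boundary₂, faceBoundary, Finsupp.linearCombination_single,
      Finset.smul_sum, smul_sub, map_sum, map_sub, Finsupp.smul_single, smul_eq_mul, mul_one]

/-- The map induced by `chainCoord` on chains modulo boundaries. -/
def chainQuotCoord :
    ((Edge k ℓ →₀ ℝ) ⧸ B₁ k ℓ ℝ) →ₗ[ℚ] ((Edge k ℓ →₀ ℚ) ⧸ B₁ k ℓ ℚ) :=
  Submodule.mapQ ((B₁ k ℓ ℝ).restrictScalars ℚ) _ (chainCoord f (Edge k ℓ)) (by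
    rintro _ ⟨y, rfl⟩
    exact ⟨chainCoord f _ y, boundary₂_chainCoord f y⟩) ∘ₗ
  (Submodule.Quotient.restrictScalarsEquiv ℚ (B₁ k ℓ ℝ)).symm.toLinearMap

/-- The map induced by `chainCoord` on homology. -/
def homologyCoord : H₁ k ℓ ℝ →ₗ[ℚ] H₁ k ℓ ℚ :=
  (chainQuotCoord f ∘ₗ (H₁ k ℓ ℝ).subtype.restrictScalars ℚ).codRestrict (H₁ k ℓ ℚ) <| by
    rintro ⟨_, x, hx, rfl⟩
    have hx' : boundary₁ k ℓ ℝ x = 0 := hx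
    refine ⟨chainCoord f _ x, ?_, rfl⟩
    change boundary₁ k ℓ ℚ (chainCoord f _ x) = 0
    rw [boundary₁_chainCoord, hx', map_zero]

theorem homologyCoord_smul_homologyExt (c : ℝ) (v : H₁ k ℓ ℚ) :
    homologyCoord f (c • homologyExt k ℓ v) = f c • v := by
  obtain ⟨_, x, hx, rfl⟩ := v
  exact Subtype.ext (congrArg (B₁ k ℓ ℚ).mkQ (chainCoord_smul_chainExt f c x))

theorem homologyRep_homologyCoord (g : SymGroup k ℓ) (v : H₁ k ℓ ℝ) :
    homologyRep k ℓ ℚ g (homologyCoord f v) = homologyCoord f (homologyRep k ℓ ℝ g v) := by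
  obtain ⟨_, x, hx, rfl⟩ := v
  exact Subtype.ext (congrArg (B₁ k ℓ ℚ).mkQ (chainRep_chainCoord f g x))

theorem homologyRep_homologyExt (g : SymGroup k ℓ) (v : H₁ k ℓ ℚ) :
    homologyRep k ℓ ℝ g (homologyExt k ℓ v) = homologyExt k ℓ (homologyRep k ℓ ℚ g v) := by
  obtain ⟨_, x, hx, rfl⟩ := v
  exact Subtype.ext (congrArg (B₁ k ℓ ℝ).mkQ (chainRep_chainExt g x))

/-- Expanding coefficients in a `ℚ`-basis of `ℝ` writes a real class through rational classes. These
inherit every `ℚ`-linear equation, with rational operators, that `v` satisfies. -/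
theorem exists_sum_smul_homologyExt {ι : Type} (b : Module.Basis ι ℚ ℝ) (v : H₁ k ℓ ℝ) :
    ∃ t : Finset ι, ∑ i ∈ t, b i • homologyExt k ℓ (homologyCoord (b.coord i) v) = v := by
  obtain ⟨_, x, hx, rfl⟩ := v
  obtain ⟨t, ht⟩ := exists_sum_smul_chainExt b x
  refine ⟨t, Subtype.ext ?_⟩
  have := congrArg (B₁ k ℓ ℝ).mkQ ht
  rw [map_sum] at this
  rw [AddSubmonoidClass.coe_finsetSum]
  exact this

/-- An eigenspace of `angleOp` for a rational eigenvalue is defined over `ℚ`. -/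
theorem isRationalSubspace_of_eigenspace {U : Subrepresentation (homologyRep k ℓ ℝ)} (q : ℚ)
    (hU : ∀ v, v ∈ U.toSubmodule ↔ angleOp k ℓ ℝ v = (q : ℝ) • v) : IsRationalSubspace U := by
  let W : Subrepresentation (homologyRep k ℓ ℚ) :=
    ⟨LinearMap.ker (angleOp k ℓ ℚ - q • LinearMap.id), fun g v hv => by
      simp only [LinearMap.mem_ker, LinearMap.sub_apply, LinearMap.smul_apply, LinearMap.id_apply,
        sub_eq_zero] at hv ⊢
      rw [angleOp_homologyRep, hv, map_smul]⟩
  have hW : ∀ w, w ∈ W.toSubmodule ↔ angleOp k ℓ ℚ w = q • w := fun w => by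
    simp [W, sub_eq_zero]
  refine ⟨W, le_antisymm (fun v hv => ?_) (Submodule.span_le.2 ?_)⟩
  · let b := Module.Free.chooseBasis ℚ ℝ
    obtain ⟨t, ht⟩ := exists_sum_smul_homologyExt b v
    rw [← ht]
    refine Submodule.sum_mem _ fun i _ =>
      Submodule.smul_mem _ _ (Submodule.subset_span ⟨_, (hW _).2 ?_, rfl⟩)
    -- Rationality of `q` is essential here: coordinate maps are only `ℚ`-linear.
    have h := congrArg (homologyCoord (b.coord i)) ((hU v).1 hv)
    rw [Rat.cast_smul_eq_qsmul, map_smul] at h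
    rw [← h]
    simp [angleOp, homologyRep_homologyCoord]
  · rintro _ ⟨w, hw, rfl⟩
    refine (hU _).2 ?_
    have h := congrArg (homologyExt k ℓ) ((hW w).1 hw)
    rw [map_smulₛₗ] at h
    rw [← eq_ratCast (algebraMap ℚ ℝ), ← h]
    simp [angleOp, homologyRep_homologyExt]

/-- A subrepresentation of real homology which is spanned by rational homology classes is
isomorphic to the extension of scalars of the rational representation that they form. -/
theorem IsRationalSubspace.isRealizableOverRat {U : Subrepresentation (homologyRep k ℓ ℝ)}
    (hU : IsRationalSubspace U) : IsRealizableOverRat U.toRepresentation := by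
  obtain ⟨W, hW⟩ := hU
  let l : W.toSubmodule →ₗ[ℚ] H₁ k ℓ ℝ :=
    { toFun w := homologyExt k ℓ w
      map_add' v w := by simp
      map_smul' c w := by simp [map_smulₛₗ, Rat.cast_smul_eq_qsmul] }
  have hrange : LinearMap.range (l.liftBaseChange ℝ) = U.toSubmodule := by
    rw [LinearMap.range_liftBaseChange, hW]
    congr 1
    ext v
    simp [l]
  -- The coordinates of the image are those of the tensor itself, so a tensor in the kernel has all
  -- coordinates zero.
  have hcoord : ∀ f : ℝ →ₗ[ℚ] ℚ, ∀ x, homologyCoord f (l.liftBaseChange ℝ x)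
      = TensorProduct.lid ℚ W.toSubmodule (f.rTensor _ x) := by
    intro f x
    induction x with
    | zero => simp
    | add x y hx hy => simp only [map_add, hx, hy, Submodule.coe_add]
    | tmul c w =>
      rw [LinearMap.liftBaseChange_tmul, LinearMap.rTensor_tmul, TensorProduct.lid_tmul]
      exact homologyCoord_smul_homologyExt f c (w : H₁ k ℓ ℚ)
  have hinj : Function.Injective (l.liftBaseChange ℝ) := by
    rw [← LinearMap.ker_eq_bot, LinearMap.ker_eq_bot']
    intro x hx
    refine eq_zero_of_forall_rTensor_eq_zero (V := W.toSubmodule) fun f => Subtype.ext ?_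
    rw [← hcoord, hx, map_zero]
    rfl
  refine ⟨W.toSubmodule, inferInstance, inferInstance, W.toRepresentation,
    (LinearEquiv.ofInjective _ hinj).trans (LinearEquiv.ofEq _ _ hrange), fun g x => ?_⟩
  refine Subtype.ext ?_
  change l.liftBaseChange ℝ ((W.toRepresentation g).baseChange ℝ x)
    = homologyRep k ℓ ℝ g (l.liftBaseChange ℝ x)
  induction x with
  | zero => simp
  | add x y hx hy => simp only [map_add, hx, hy]
  | tmul c w =>
    rw [LinearMap.baseChange_tmul, LinearMap.liftBaseChange_tmul, LinearMap.liftBaseChange_tmul,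
      map_smul]
    exact congrArg (c • ·) (homologyRep_homologyExt g (w : H₁ k ℓ ℚ)).symm

end Coord

/-! ### The rationality obstruction -/

/-- If a real representation is defined over `ℚ`, then the sum of the actions of two group
elements can be a scalar only if this scalar is rational. -/
theorem IsRealizableOverRat.exists_rat {G U : Type} [Group G] [AddCommGroup U] [Module ℝ U]
    [Nontrivial U] {τ : Representation ℝ G U} (hτ : IsRealizableOverRat τ) {g h : G} {c : ℝ}
    (hc : ∀ u, τ g u + τ h u = c • u) : ∃ q : ℚ, c = q := by
  obtain ⟨V, _, _, ρ, e, he⟩ := hτ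
  obtain ⟨v, hv⟩ : ∃ v : V, v ≠ 0 := by
    by_contra! hV
    have : Subsingleton V := ⟨fun x y => by rw [hV x, hV y]⟩
    exact not_subsingleton U e.symm.toEquiv.subsingleton
  -- Applying `φ` to the scalar equation at `1 ⊗ v` reads off `c` as a value of `φ`, hence as a
  -- rational number.
  obtain ⟨φ, hφ⟩ := Module.Projective.exists_dual_eq_one ℚ hv
  have h1 : (ρ g).baseChange ℝ (1 ⊗ₜ v) + (ρ h).baseChange ℝ (1 ⊗ₜ v) = c • ((1 : ℝ) ⊗ₜ[ℚ] v) :=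
    e.injective (by rw [map_add, he, he, hc, map_smul])
  rw [LinearMap.baseChange_tmul, LinearMap.baseChange_tmul, ← TensorProduct.tmul_add,
    TensorProduct.smul_tmul', smul_eq_mul, mul_one] at h1
  have h2 := congrArg (TensorProduct.rid ℚ ℝ ∘ φ.lTensor ℝ) h1
  simp only [Function.comp_apply, LinearMap.lTensor_tmul, TensorProduct.rid_tmul, hφ, one_smul]
    at h2
  exact ⟨φ (ρ g v + ρ h v), by rw [← h2, Rat.smul_def, mul_one]⟩

/-! ### Rational cosines -/

variable [NeZero k]

theorem angleTrace_natCast (r : ℕ) :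
    angleTrace (r : ZMod (2 * k)) = 2 * Real.cos (((r / k : ℚ) : ℝ) * Real.pi) := by
  have hk : (k : ℂ) ≠ 0 := Nat.cast_ne_zero.2 (NeZero.ne k)
  rw [angleTrace, ZMod.toCircle_natCast, ← Complex.exp_ofReal_mul_I_re]
  congr 3
  push_cast
  field_simp

/-- By Niven's theorem, a rational `x` in `[0, 1]` with `cos (π x)` rational is 0, 1/3, 1/2, 2/3 or
1. Here `x = r / k` is positive, and halving gives the list. -/
theorem exists_rat_angleTrace_iff {r : ℕ} (hr : 0 < r) (hrk : r ≤ k) :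
    (∃ q : ℚ, angleTrace (r : ZMod (2 * k)) = q) ↔
      (r : ℚ) / (2 * (k : ℚ)) ∈ ({1 / 6, 1 / 4, 1 / 3, 1 / 2} : Set ℚ) := by
  have hk : (0 : ℚ) < k := Nat.cast_pos.2 (NeZero.pos k)
  have hr' : (0 : ℚ) < r := Nat.cast_pos.2 hr
  have h1 : (r : ℚ) / (2 * k) = r / k / 2 := by field_simp
  have h2 : 0 < (r : ℚ) / k := by positivity
  have h3 : (r : ℚ) / k ≤ 1 := (div_le_one hk).2 (Nat.cast_le.2 hrk)
  rw [angleTrace_natCast, h1]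
  generalize (r : ℚ) / k = x at h2 h3 ⊢
  simp only [Set.mem_insert_iff, Set.mem_singleton_iff]
  constructor
  · rintro ⟨q, hq⟩
    have := niven_angle_div_pi_eq (r := x) ⟨q / 2, by push_cast; linarith⟩ ⟨h2.le, h3⟩
    simp only [Set.mem_insert_iff, Set.mem_singleton_iff] at this
    rcases this with rfl | rfl | rfl | rfl | rfl
    · exact absurd h2 (lt_irrefl _)
    all_goals norm_num
  · rintro (h | h | h | h)
    · obtain rfl : x = 1 / 3 := by linarith
      refine ⟨1, ?_⟩
      rw [show ((1 / 3 : ℚ) : ℝ) * Real.pi = Real.pi / 3 by push_cast; ring,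
        Real.cos_pi_div_three]
      norm_num
    · obtain rfl : x = 1 / 2 := by linarith
      refine ⟨0, ?_⟩
      rw [show ((1 / 2 : ℚ) : ℝ) * Real.pi = Real.pi / 2 by push_cast; ring, Real.cos_pi_div_two]
      norm_num
    · obtain rfl : x = 2 / 3 := by linarith
      refine ⟨-1, ?_⟩
      rw [show ((2 / 3 : ℚ) : ℝ) * Real.pi = Real.pi - Real.pi / 3 by push_cast; ring,
        Real.cos_pi_sub, Real.cos_pi_div_three]
      norm_num
    · obtain rfl : x = 1 := by linarith
      exact ⟨-2, by norm_num⟩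

end VeechMcMullen

end

/-! ### The cycle of implications between both notions and the rationality of the eigenvalue -/

theorem mainTheorem11 (k ℓ : ℕ) [NeZero k] [NeZero ℓ] (hℓ : 3 ≤ ℓ) (r : ℕ) (hr : 0 < r)
    (hrk : r ≤ k) :
    (VeechMcMullen.IsRationalSubspace (VeechMcMullen.Hr k ℓ r) ↔
      (r : ℚ) / (2 * (k : ℚ)) ∈ ({1 / 6, 1 / 4, 1 / 3, 1 / 2} : Set ℚ)) ∧
    (VeechMcMullen.IsRealizableOverRat (VeechMcMullen.Hr k ℓ r).toRepresentation ↔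
      (r : ℚ) / (2 * (k : ℚ)) ∈ ({1 / 6, 1 / 4, 1 / 3, 1 / 2} : Set ℚ)) := by
  rw [← VeechMcMullen.exists_rat_angleTrace_iff hr hrk]
  have hsub : (∃ q : ℚ, VeechMcMullen.angleTrace (r : ZMod (2 * k)) = q) →
      VeechMcMullen.IsRationalSubspace (VeechMcMullen.Hr k ℓ r) := by
    rintro ⟨q, hq⟩
    refine VeechMcMullen.isRationalSubspace_of_eigenspace q fun v => ?_
    rw [← hq]
    exact ⟨VeechMcMullen.angleOp_of_mem_Hr, VeechMcMullen.mem_Hr_of_angleOp hr hrk⟩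
  have hreal : VeechMcMullen.IsRealizableOverRat (VeechMcMullen.Hr k ℓ r).toRepresentation →
      ∃ q : ℚ, VeechMcMullen.angleTrace (r : ZMod (2 * k)) = q := by
    intro h
    have : Nontrivial (VeechMcMullen.Hr k ℓ r).toSubmodule :=
      Submodule.nontrivial_iff_ne_bot.2 (VeechMcMullen.Hr_ne_bot hr hrk hℓ)
    exact h.exists_rat (g := ⟨1, 0, 1⟩) (h := ⟨-1, 0, 1⟩) fun u =>
      Subtype.ext (VeechMcMullen.angleOp_of_mem_Hr u.2)
  exact ⟨⟨fun h => hreal h.isRealizableOverRat, hsub⟩,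
    ⟨hreal, fun h => (hsub h).isRealizableOverRat⟩⟩
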